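/- Let $k\ge 0$ be an integer. The moduli space of charge-$k$ local Abelian vortices on the round sphere $S^2\cong\mathbb{CP}^1$ is described as the space $\mathcal M_k=\mathrm{Sym}^k(\mathbb{CP}^1)$ of effective divisors of degree $k$ (unordered vortex positions); $q\in U(1)$ acts on it by the rotation $z\mapsto qz$ of the sphere. (1) Sending the configuration with positions $z_1,\dots,z_k$ to $[w_0:\dots:w_k]$, where $\prod_i(z-z_i)=w_0z^k+w_1z^{k-1}+\dots+w_k$ (for $z_i=[a_i:b_i]$, possibly $\infty$, replace $z-z_i$ by $b_iz-a_i$), defines a homeomorphism $\mathcal M_k\cong\mathbb{CP}^k$ which intertwines the rotation action with the action $w_j\mapsto q^jw_j$ of weights $0,\dots,k$. Moreover $w\mapsto\sum_jw_jx_0^{k-j}x_1^j$ is a linear isomorphism of $\mathbb C^{k+1}$ with $H^0(\mathbb{CP}^1,\mathcal O(k))$, so that $\mathbb{CP}^k$ is the projective space of holomorphic sections of the degree-$k$ line bundle on the sphere. For $m\in\mathbb Z$ let $U(1)$ act on $H^p(\mathbb{CP}^k,\mathcal O(m))$ by pullback of sections along $w\mapsto(w_0,qw_1,\dots,q^kw_k)$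 (so the fibre of $\mathcal O(m)$ at the $i$-th coordinate point has character $q^{mi}$), and put $$\chi_{U(1)}(\mathcal O(m);q)=\sum_{p}(-1)^p\,\mathrm{tr}_{H^p(\mathbb{CP}^k,\mathcal O(m))}(q),\qquad q\in U(1).$$ For $n\in\mathbb Z$ let $$\binom{n}{k}_q=\prod_{i=1}^{k}\frac{1-q^{\,n-k+i}}{1-q^{i}} .$$ (2) Let $\mathcal A,\lambda\in\mathbb Z$ and $d=\mathcal A-k$. All $H^p(\mathbb{CP}^k,\mathcal O(\lambda d))$ are finite dimensional, and $$\chi_{U(1)}(\mathcal O(\lambda d);q)=\binom{\lambda d+k}{k}_q$$ for every $q\in U(1)$ with $q^i\ne1$ for $1\le i\le k$; at every other $q_0\in U(1)$ the equality holds with the right side replaced by its limit as $q\to q_0$. (3) In particular, at $\lambda=1$, $\chi_{U(1)}(\mathcal O(d);q)=\binom{\mathcal A}{k}_q$, in the same sense. (4) As $q\to1$, $\chi_{U(1)}(\mathcal O(\lambda d);q)$ tends to its value at $q=1$, which is the Euler characteristic $\chi(\mathcal O(\lambda d))=\sum_p(-1)^p\dim H^p(\mathbb{CP}^k,\mathcal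 O(\lambda d))$ and equals the value at $g=0$ of the genus-$g$ formula $$\sum_{j=0}^{g}\lambda^j\binom gj\binom{\lambda(\mathcal A-k)+k-g}{k-j},$$ namely $\binom{\lambda(\mathcal A-k)+k}{k}$. Moreover $\lim_{q\to1}\binom nk_q=\binom nk$ for all $n\in\mathbb Z$. -/

import Mathlib

open scoped LinearAlgebra.Projectivization Topology

noncomputable section

namespace HarmonicTrap

/-! ### Projective space, the rotation actions, and vortex positions -/

/-- Complex projective space `ℂP^k`, with homogeneous coordinates `[w_0 : ⋯ : w_k]`. -/
abbrev CP (k : ℕ) : Type := ℙ ℂ (Fin (k + 1) → ℂ)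

/-- The quotient topology on `ℂP^k`. -/
instance instTopologicalSpaceCP (k : ℕ) : TopologicalSpace (CP k) :=
  TopologicalSpace.coinduced
    (Projectivization.mk' ℂ : {w : Fin (k + 1) → ℂ // w ≠ 0} → CP k) inferInstance

/-- The unordered `k`-tuple underlying an ordered one. -/
def unordered {X : Type} {k : ℕ} (x : Fin k → X) : Sym X k :=
  ⟨Finset.univ.val.map x, by simp⟩

/-- The moduli space of `k` local Abelian vortices on the sphere `S² = ℂP¹`: the space of effective
divisors of degree `k`, i.e. the symmetric product `Sym^k(ℂP¹)`. The point `[a : b]` of `ℂP¹` is the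
point of the sphere with complex coordinate `z = a / b`. -/
def VortexModuli (k : ℕ) : Type := Sym (CP 1) k

/-- The quotient topology on `Sym^k(ℂP¹) = (ℂP¹)^k / S_k`. -/
instance instTopologicalSpaceVortexModuli (k : ℕ) : TopologicalSpace (VortexModuli k) :=
  TopologicalSpace.coinduced (unordered : (Fin k → CP 1) → Sym (CP 1) k) inferInstance

/-- The linear map `(w_0, …, w_k) ↦ (w_0, q w_1, …, q^k w_k)`, for `q ∈ U(1)`. -/
def weightMap (k : ℕ) (q : Circle) : (Fin (k + 1) → ℂ) →ₗ[ℂ] (Fin (k + 1) → ℂ) where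
  toFun w := fun j => (q : ℂ) ^ (j : ℕ) * w j
  map_add' v w := by ext j; simp [mul_add]
  map_smul' c w := by ext j; simp; ring

theorem weightMap_injective (k : ℕ) (q : Circle) : Function.Injective (weightMap k q) := by
  intro v w h
  ext j
  have := congrFun h j
  simpa [weightMap] using this

theorem weightMap_one (k : ℕ) (w : Fin (k + 1) → ℂ) : weightMap k 1 w = w := by
  funext j
  simp [weightMap]

theorem weightMap_mul (k : ℕ) (q r : Circle) (w : Fin (k + 1) → ℂ) :
    weightMap k (q * r) w = weightMap k r (weightMap k q w) := by
  funext j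
  simp only [weightMap, LinearMap.coe_mk, AddHom.coe_mk, Circle.coe_mul]
  ring

/-- The action of `U(1)` on `ℂP^k` with weights `0, 1, …, k`. -/
def weightAction (k : ℕ) (q : Circle) : CP k → CP k :=
  Projectivization.map (weightMap k q) (weightMap_injective k q)

/-- The linear map `(a, b) ↦ (q a, b)`. -/
def rotationMap (q : Circle) : (Fin 2 → ℂ) →ₗ[ℂ] (Fin 2 → ℂ) where
  toFun v := ![(q : ℂ) * v 0, v 1]
  map_add' v w := by ext j; fin_cases j <;> simp [mul_add]
  map_smul' c w := by
    ext j
    fin_cases j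
    · simp
      ring
    · simp

theorem rotationMap_injective (q : Circle) : Function.Injective (rotationMap q) := by
  intro v w h
  have h0 := congrFun h 0
  have h1 := congrFun h 1
  ext j
  fin_cases j
  · simpa [rotationMap] using h0
  · simpa [rotationMap] using h1

/-- The rotation `z ↦ q z` of the sphere about the axis through `z = 0` and `z = ∞`. -/
def rotateSphere (q : Circle) : CP 1 → CP 1 :=
  Projectivization.map (rotationMap q) (rotationMap_injective q)

/-- The rotation of a vortex configuration. -/
def rotateVortices (k : ℕ) (q : Circle) (D : VortexModuli k) : VortexModuli k :=
  Sym.map (rotateSphere q) D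

/-- The coefficients `w_0, …, w_k` in `∏_i (b_i z - a_i) = w_0 z^k + w_1 z^(k-1) + ⋯ + w_k`, where
`v i = (a_i, b_i)`. For `b_i = 1` this is the polynomial `∏_i (z - z_i)` with `z_i = a_i`; a point
`z_i = ∞` is given by `b_i = 0`. -/
def vortexCoords {k : ℕ} (v : Fin k → Fin 2 → ℂ) : Fin (k + 1) → ℂ := fun j =>
  (∏ i, (Polynomial.C (v i 1) * Polynomial.X - Polynomial.C (v i 0))).coeff (k - (j : ℕ))

/-! ### The sheaf of holomorphic sections of `𝒪(m)` on `ℂP^k` -/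

/-- The cone in `ℂ^(k+1) ∖ {0}` over a subset of `ℂP^k`. -/
def cone {k : ℕ} (U : Set (CP k)) : Set (Fin (k + 1) → ℂ) :=
  {w | ∃ h : w ≠ 0, Projectivization.mk ℂ w h ∈ U}

theorem cone_mono {k : ℕ} {U V : Set (CP k)} (h : V ⊆ U) : cone V ⊆ cone U :=
  fun _ ⟨hw, hV⟩ => ⟨hw, h hV⟩

/-- Holomorphic sections of `𝒪(m)` over an open set `U ⊆ ℂP^k`: holomorphic functions on the cone
over `U`, homogeneous of degree `m`. A function on the cone is represented by its extension by zero
to `ℂ^(k+1)`. -/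
def holSections (k : ℕ) (m : ℤ) (U : Set (CP k)) : Submodule ℂ ((Fin (k + 1) → ℂ) → ℂ) where
  carrier := {s | DifferentiableOn ℂ s (cone U) ∧
    (∀ t : ℂ, t ≠ 0 → ∀ w ∈ cone U, s (t • w) = t ^ m * s w) ∧ ∀ w ∉ cone U, s w = 0}
  add_mem' := by
    rintro s s' ⟨h1, h2, h3⟩ ⟨h1', h2', h3'⟩
    refine ⟨h1.add h1', fun t ht w hw => ?_, fun w hw => ?_⟩
    · simp [h2 t ht w hw, h2' t ht w hw, mul_add]
    · simp [h3 w hw, h3' w hw]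
  zero_mem' := ⟨differentiableOn_const 0, by simp, by simp⟩
  smul_mem' := by
    rintro c s ⟨h1, h2, h3⟩
    refine ⟨h1.const_smul c, fun t ht w hw => ?_, fun w hw => ?_⟩
    · simp only [Pi.smul_apply, h2 t ht w hw, smul_eq_mul]; ring
    · simp [h3 w hw]

theorem smul_mem_cone {k : ℕ} {U : Set (CP k)} {t : ℂ} (ht : t ≠ 0) {w : Fin (k + 1) → ℂ}
    (hw : w ∈ cone U) : t • w ∈ cone U := by
  obtain ⟨h, hU⟩ := hw
  refine ⟨smul_ne_zero ht h, ?_⟩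
  have : Projectivization.mk ℂ (t • w) (smul_ne_zero ht h) = Projectivization.mk ℂ w h :=
    (Projectivization.mk_eq_mk_iff' ℂ _ _ _ _).2 ⟨t, rfl⟩
  rwa [this]

/-- Restriction of sections of `𝒪(m)` to a smaller set. -/
def restrictSection {k : ℕ} (m : ℤ) {U V : Set (CP k)} (h : V ⊆ U) :
    holSections k m U →ₗ[ℂ] holSections k m V where
  toFun s := ⟨(cone V).indicator s.1, by
    refine ⟨?_, fun t ht w hw => ?_, fun w hw => Set.indicator_of_notMem hw _⟩
    · exact (s.2.1.mono (cone_mono h)).congr fun w hw => Set.indicator_of_mem hw _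
    · rw [Set.indicator_of_mem hw, Set.indicator_of_mem (smul_mem_cone ht hw),
        s.2.2.1 t ht w (cone_mono h hw)]⟩
  map_add' s s' := Subtype.ext (Set.indicator_add _ _ _)
  map_smul' c s := Subtype.ext (Set.indicator_const_smul (cone V) c s.1)

/-! ### Cohomology of `𝒪(m)`: the Čech complex of the standard cover -/

/-- The standard affine open set `{w_i ≠ 0}` of `ℂP^k`. -/
def chart {k : ℕ} (i : Fin (k + 1)) : Set (CP k) := {p | p.rep i ≠ 0}

/-- The intersection of the standard affine open sets with index in `S`. -/
def chartInter {k : ℕ} (S : Finset (Fin (k + 1))) : Set (CP k) := {p | ∀ i ∈ S, p ∈ chart i}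

theorem chartInter_erase {k : ℕ} (S : Finset (Fin (k + 1))) (i : Fin (k + 1)) :
    chartInter S ⊆ chartInter (S.erase i) :=
  fun _ hp j hj => hp j (Finset.mem_of_mem_erase hj)

/-- (Ordered) Čech cochains of degree `p`: a section over `U_{i_0} ∩ ⋯ ∩ U_{i_p}` for each
`i_0 < ⋯ < i_p`. -/
def Cochains (k : ℕ) (m : ℤ) (p : ℕ) : Type :=
  (S : {S : Finset (Fin (k + 1)) // S.card = p + 1}) → holSections k m (chartInter S.1)

instance instAddCommGroupCochains (k : ℕ) (m : ℤ) (p : ℕ) : AddCommGroup (Cochains k m p) :=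
  inferInstanceAs (AddCommGroup
    ((S : {S : Finset (Fin (k + 1)) // S.card = p + 1}) → holSections k m (chartInter S.1)))

instance instModuleCochains (k : ℕ) (m : ℤ) (p : ℕ) : Module ℂ (Cochains k m p) :=
  inferInstanceAs (Module ℂ
    ((S : {S : Finset (Fin (k + 1)) // S.card = p + 1}) → holSections k m (chartInter S.1)))

/-- The Čech differential
`(δ f)_{i_0 ⋯ i_{p+1}} = ∑_a (-1)^a f_{i_0 ⋯ î_a ⋯ i_{p+1}}`. -/
def cechD (k : ℕ) (m : ℤ) (p : ℕ) : Cochains k m p →ₗ[ℂ] Cochains k m (p + 1) where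
  toFun f := fun S => ∑ i : {i // i ∈ S.1},
    ((-1 : ℂ) ^ (S.1.filter (fun j => j < i.1)).card) •
      restrictSection m (chartInter_erase S.1 i.1)
        (f ⟨S.1.erase i.1, by rw [Finset.card_erase_of_mem i.2, S.2]; rfl⟩)
  map_add' f g := by
    funext S
    refine Eq.trans ?_ Finset.sum_add_distrib
    refine Finset.sum_congr rfl fun i _ => ?_
    rw [← smul_add, ← map_add]
    rfl
  map_smul' c f := by
    funext S
    refine Eq.trans ?_ (Finset.smul_sum (r := c)).symm
    refine Finset.sum_congr rfl fun i _ => ?_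
    refine Eq.trans ?_ (smul_comm _ _ _)
    exact congrArg _ ((restrictSection m _).map_smul c _)

/-- Čech cocycles of degree `p`. -/
def cocycles (k : ℕ) (m : ℤ) (p : ℕ) : Submodule ℂ (Cochains k m p) := LinearMap.ker (cechD k m p)

/-- Čech coboundaries of degree `p`. -/
def coboundaries (k : ℕ) (m : ℤ) : (p : ℕ) → Submodule ℂ (Cochains k m p)
  | 0 => ⊥
  | p + 1 => LinearMap.range (cechD k m p)

/-- The cohomology group `H^p(ℂP^k, 𝒪(m))`. The cover is by Stein open sets all of whose
intersections are Stein, so this Čech cohomology is the cohomology of the sheaf `𝒪(m)`. -/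
abbrev Cohomology (k : ℕ) (m : ℤ) (p : ℕ) : Type :=
  cocycles k m p ⧸ (coboundaries k m p).submoduleOf (cocycles k m p)

/-! ### The action of `U(1)` on the cohomology -/

theorem mem_cone_chartInter {k : ℕ} (S : Finset (Fin (k + 1))) (w : Fin (k + 1) → ℂ) :
    w ∈ cone (chartInter S) ↔ w ≠ 0 ∧ ∀ i ∈ S, w i ≠ 0 := by
  have key : ∀ h : w ≠ 0, ∀ i, (Projectivization.mk ℂ w h).rep i ≠ 0 ↔ w i ≠ 0 := by
    intro h i
    obtain ⟨a, ha⟩ := Projectivization.exists_smul_eq_mk_rep ℂ w h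
    rw [← ha]
    simp [Units.smul_def]
  constructor
  · rintro ⟨h, hS⟩
    exact ⟨h, fun i hi => (key h i).1 (hS i hi)⟩
  · rintro ⟨h, hS⟩
    exact ⟨h, fun i hi => (key h i).2 (hS i hi)⟩

theorem weightMap_mem_cone {k : ℕ} (S : Finset (Fin (k + 1))) (q : Circle)
    (w : Fin (k + 1) → ℂ) :
    weightMap k q w ∈ cone (chartInter S) ↔ w ∈ cone (chartInter S) := by
  rw [mem_cone_chartInter, mem_cone_chartInter,
    (map_ne_zero_iff (weightMap k q) (weightMap_injective k q))]
  simp [weightMap]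

/-- Pullback of sections of `𝒪(m)` along `w ↦ (w_0, q w_1, …, q^k w_k)`. -/
def pullSection {k : ℕ} (m : ℤ) (S : Finset (Fin (k + 1))) (q : Circle) :
    holSections k m (chartInter S) →ₗ[ℂ] holSections k m (chartInter S) where
  toFun s := ⟨s.1 ∘ weightMap k q, by
    refine ⟨?_, fun t ht w hw => ?_, fun w hw => ?_⟩
    · exact s.2.1.comp (LinearMap.toContinuousLinearMap (weightMap k q)).differentiable.differentiableOn
        fun w hw => (weightMap_mem_cone S q w).2 hw
    · simp only [Function.comp_apply, map_smul]
      exact s.2.2.1 t ht _ ((weightMap_mem_cone S q w).2 hw)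
    · exact s.2.2.2 _ fun h => hw ((weightMap_mem_cone S q w).1 h)⟩
  map_add' s s' := rfl
  map_smul' c s := rfl

/-- Pullback of Čech cochains. -/
def pullCochain (k : ℕ) (m : ℤ) (p : ℕ) (q : Circle) : Cochains k m p →ₗ[ℂ] Cochains k m p where
  toFun f := fun S => pullSection m S.1 q (f S)
  map_add' _ _ := rfl
  map_smul' _ _ := rfl

theorem restrictSection_pullSection {k : ℕ} (m : ℤ) (S : Finset (Fin (k + 1)))
    (i : Fin (k + 1)) (q : Circle) (s : holSections k m (chartInter (S.erase i))) :
    restrictSection m (chartInter_erase S i) (pullSection m (S.erase i) q s) =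
      pullSection m S q (restrictSection m (chartInter_erase S i) s) := by
  apply Subtype.ext
  funext w
  change (cone (chartInter S)).indicator (s.1 ∘ weightMap k q) w =
    (cone (chartInter S)).indicator s.1 (weightMap k q w)
  by_cases hw : w ∈ cone (chartInter S)
  · rw [Set.indicator_of_mem hw, Set.indicator_of_mem ((weightMap_mem_cone S q w).2 hw)]
    rfl
  · rw [Set.indicator_of_notMem hw,
      Set.indicator_of_notMem fun h => hw ((weightMap_mem_cone S q w).1 h)]

theorem cechD_pullCochain (k : ℕ) (m : ℤ) (p : ℕ) (q : Circle) (f : Cochains k m p) :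
    cechD k m p (pullCochain k m p q f) = pullCochain k m (p + 1) q (cechD k m p f) := by
  funext S
  refine Eq.trans ?_ (map_sum (pullSection m S.1 q) _ _).symm
  refine Finset.sum_congr rfl fun i _ => ?_
  rw [map_smul, ← restrictSection_pullSection]
  rfl

theorem pullCochain_one (k : ℕ) (m : ℤ) (p : ℕ) : pullCochain k m p 1 = LinearMap.id := by
  refine LinearMap.ext fun f => funext fun S => Subtype.ext (funext fun w => ?_)
  exact congrArg (f S).1 (weightMap_one k w)

theorem pullCochain_mul (k : ℕ) (m : ℤ) (p : ℕ) (q r : Circle) :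
    pullCochain k m p (q * r) = pullCochain k m p q ∘ₗ pullCochain k m p r := by
  refine LinearMap.ext fun f => funext fun S => Subtype.ext (funext fun w => ?_)
  exact congrArg (f S).1 (weightMap_mul k q r w)

theorem pullCochain_mem_cocycles (k : ℕ) (m : ℤ) (p : ℕ) (q : Circle) :
    ∀ f ∈ cocycles k m p, pullCochain k m p q f ∈ cocycles k m p := by
  intro f hf
  rw [cocycles, LinearMap.mem_ker] at hf ⊢
  rw [cechD_pullCochain, hf, map_zero]

theorem pullCochain_mem_coboundaries (k : ℕ) (m : ℤ) (p : ℕ) (q : Circle) :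
    ∀ f ∈ coboundaries k m p, pullCochain k m p q f ∈ coboundaries k m p := by
  cases p with
  | zero =>
    intro f hf
    have : f = 0 := by simpa [coboundaries] using hf
    rw [this, map_zero]
    exact Submodule.zero_mem _
  | succ p =>
    rintro _ ⟨g, rfl⟩
    exact ⟨pullCochain k m p q g, cechD_pullCochain k m p q g⟩

/-- The representation of `U(1)` on `H^p(ℂP^k, 𝒪(m))` induced by the action with weights
`0, …, k` on `ℂ^(k+1)`: an element `q ∈ U(1)` acts on sections by pullback, `s ↦ s(q · w)`. Thus the
homogeneous coordinate `w_j`, a section of `𝒪(1)`, has weight `j`, and the fibre of `𝒪(m)` at the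
fixed point `p_i = [0 : ⋯ : 1 : ⋯ : 0]` has character `q^(m i)`. -/
def cohomologyRep (k : ℕ) (m : ℤ) (p : ℕ) : Representation ℂ Circle (Cohomology k m p) where
  toFun q := Submodule.mapQ _ _
    ((pullCochain k m p q).restrict (pullCochain_mem_cocycles k m p q))
    (fun f hf => pullCochain_mem_coboundaries k m p q f.1 hf)
  map_one' := by
    refine Submodule.linearMap_qext _ (LinearMap.ext fun f => ?_)
    refine congrArg (Submodule.Quotient.mk) (Subtype.ext ?_)
    exact LinearMap.congr_fun (pullCochain_one k m p) f.1
  map_mul' q r := by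
    refine Submodule.linearMap_qext _ (LinearMap.ext fun f => ?_)
    refine congrArg (Submodule.Quotient.mk) (Subtype.ext ?_)
    exact LinearMap.congr_fun (pullCochain_mul k m p q r) f.1

/-- The equivariant Euler characteristic
`χ_{U(1)}(𝒪(m); q) = ∑_p (-1)^p tr_{H^p(ℂP^k, 𝒪(m))}(q)`; there are no cochains of degree `p > k`. -/
def equivariantEuler (k : ℕ) (m : ℤ) (q : Circle) : ℂ :=
  ∑ p ∈ Finset.range (k + 1), (-1) ^ p * LinearMap.trace ℂ _ (cohomologyRep k m p q)

/-- The Euler characteristic `χ(𝒪(m)) = ∑_p (-1)^p dim H^p(ℂP^k, 𝒪(m))`. -/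
def eulerChar (k : ℕ) (m : ℤ) : ℤ :=
  ∑ p ∈ Finset.range (k + 1), (-1) ^ p * (Module.finrank ℂ (Cohomology k m p) : ℤ)

/-! ### Gaussian binomial coefficients and the genus `g` formula -/

/-- The Gaussian binomial coefficient
`[n choose k]_q = ((1 - q^n)(1 - q^(n-1)) ⋯ (1 - q^(n-k+1))) / ((1 - q^k) ⋯ (1 - q))`, for integral
`n`, as a function of `q`. It is meant for `q` with `q, q², …, q^k ≠ 1`. -/
def gaussBinom (n : ℤ) (k : ℕ) (q : ℂ) : ℂ :=
  (∏ i ∈ Finset.range k, (1 - q ^ (n - (i : ℤ)))) / ∏ i ∈ Finset.range k, (1 - q ^ (i + 1))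

/-- The Hilbert polynomial of the quantum line bundle for charge `k` local Abelian vortices on a
surface of genus `g` and dimensionless area `A`:
`∑_{j=0}^g λ^j (g choose j) (λ(A - k) + k - g choose k - j)`. -/
def localAbelianHilbert (g k : ℕ) (lam A : ℤ) : ℤ :=
  ∑ j ∈ Finset.range (g + 1), lam ^ j * (g.choose j : ℤ) *
    (if j ≤ k then Ring.choose (lam * (A - k) + k - g) (k - j) else 0)

end HarmonicTrap

end

/-!
The theorem has three independent parts.

*The moduli space.* The product of the linear factors `b_i z - a_i` of a divisor on `ℂP¹` is a
polynomial of degree at most `k`, well defined up to a constant; the point at infinity contributes a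
constant factor, so that it is seen by the drop in degree. Since `ℂ` is algebraically closed and
`ℂ[X]` is factorial, this is a bijection from `Sym^k(ℂP¹)` to `ℂP^k` (`vortexMap_bijective`). It is
continuous because the coefficients of a product depend continuously on those of the factors, and a
continuous bijection from a compact space to a Hausdorff space is a homeomorphism.

*The cohomology.* A holomorphic function on `{w ∈ ℂ^(k+1) | w_i ≠ 0 for i ∈ S}` is determined by its
Laurent coefficients, the integrals `laurentCoeff` over the torus `|w_i| = 1`
(`eqOn_of_laurentCoeff_eq`). Rotations of the torus multiply them by characters, so they see both the
degree of homogeneity and the action of `U(1)`. A coefficient with a negative exponent at some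
`i ∉ S` vanishes. For each variable `w_i`, discarding the negative powers of `w_i` is given by a
Cauchy integral and extends a section from `S ∪ {i}` to `S` (`exists_nonnegative_part`). This yields
a contracting homotopy of the Čech complex in positive degree, up to cochains supported on the sets
`S ∋ i` and having only negative powers of `w_i`. Applying it for all `i` in turn leaves the
functions on the intersection of all charts whose exponents are all negative
(`exists_cohomologous_negative`). Hence monomials of degree `m` with nonnegative exponents form a
basis of `H^0`, those with negative exponents form a basis of `H^k`, and the other groups vanish;
for `k = 0`, both kinds contribute to `H^0`. The same expansion shows that the sections of `𝒪(k)` on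
`ℂP¹` are the binary forms of degree `k`.

*The index.* Consequently `χ(𝒪(m); q)` is the sum of `q ^ (∑ j a_j)` over the exponents `a ≥ 0` of
degree `m`, plus `(-1) ^ k` times the sum over the exponents `a < 0`. Splitting off the last variable
gives `χ_(k+1)(m) = χ_k(m) + q ^ (k+1) χ_(k+1)(m-1)` for all integers `m`
(`monomialCharacter_succ`). Gaussian binomial coefficients, and binomial coefficients at `q = 1`,
satisfy the same recursion with the same values for `k = 0` and for `m = 0`, which determine the
solution (`eq_of_pascal`). The limits follow because the character is continuous in `q ≠ 0`.
-/

noncomputable section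

namespace HarmonicTrap

/-! ### Averages over circles and Laurent coefficients in one variable -/

section

open MeasureTheory AddCircle Real

/-- The point `e^{2πit}` of the unit circle in `ℂ`. -/
def circlePt (t : UnitAddCircle) : ℂ := (AddCircle.toCircle t : ℂ)

@[simp] theorem norm_circlePt (t : UnitAddCircle) : ‖circlePt t‖ = 1 := Circle.norm_coe _

@[simp] theorem circlePt_ne_zero (t : UnitAddCircle) : circlePt t ≠ 0 := Circle.coe_ne_zero _

theorem circlePt_add (s t : UnitAddCircle) : circlePt (s + t) = circlePt s * circlePt t := by
  simp [circlePt, AddCircle.toCircle_add]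

@[fun_prop] theorem continuous_circlePt : Continuous circlePt :=
  continuous_subtype_val.comp AddCircle.continuous_toCircle

theorem exists_circlePt_eq {z : ℂ} (hz : ‖z‖ = 1) : ∃ t, circlePt t = z := by
  refine ⟨((Complex.arg z / (2 * π) : ℝ) : UnitAddCircle), ?_⟩
  rw [circlePt, AddCircle.toCircle_apply_mk, Circle.coe_exp]
  have h := Complex.norm_mul_exp_arg_mul_I z
  rw [hz] at h
  have h2 : 2 * π / 1 * (z.arg / (2 * π)) = z.arg := by field_simp
  rw [h2]
  simpa using h

/-- Averages over circles as integrals for the normalised Haar measure on `ℝ / ℤ`. -/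
theorem integral_circlePt (φ : ℂ → ℂ) (R : ℝ) :
    ∫ t : UnitAddCircle, φ (R * circlePt t) ∂haarAddCircle = circleAverage φ 0 R := by
  have h := fourierCoeff_eq_intervalIntegral (fun t : UnitAddCircle => φ (R * circlePt t)) 0 0
  simp only [fourierCoeff, neg_zero, fourier_zero, one_smul, zero_add, ne_eq, one_ne_zero,
    not_false_eq_true, div_self] at h
  rw [h, circleAverage_def]
  have h2 := intervalIntegral.integral_comp_mul_left (a := 0) (b := 1)
    (fun θ => φ (circleMap 0 R θ)) (c := 2 * π) (by positivity)
  rw [mul_zero, mul_one] at h2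
  rw [← h2]
  refine intervalIntegral.integral_congr fun x _ => ?_
  simp only [circlePt, AddCircle.toCircle_apply_mk, circleMap, Circle.coe_exp]
  simp

/-- Cauchy's theorem on an annulus: averages over circles around the origin do not depend on the
radius. -/
theorem circleAverage_eq_of_differentiableOn {φ : ℂ → ℂ} (h : DifferentiableOn ℂ φ {0}ᶜ) {r R : ℝ}
    (hr : 0 < r) (hR : 0 < R) : circleAverage φ 0 r = circleAverage φ 0 R := by
  wlog hle : r ≤ R generalizing r R
  · exact (this hR hr (le_of_not_ge hle)).symm
  rw [circleAverage_eq_circleIntegral hr.ne', circleAverage_eq_circleIntegral hR.ne',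
    Complex.circleIntegral_sub_center_inv_smul_eq_of_differentiable_on_annulus_off_countable hr hle
      Set.countable_empty]
  · refine h.continuousOn.mono fun z hz => ?_
    rintro rfl
    simp [hr] at hz
  · intro z hz
    refine h.differentiableAt (isOpen_compl_singleton.mem_nhds ?_)
    rintro rfl
    simp [hr.le] at hz

/-- The `n`-th Laurent coefficient of a function, as an average over the unit circle. -/
def circleCoeff (φ : ℂ → ℂ) (n : ℤ) : ℂ := circleAverage (fun z => z ^ (-n) * φ z) 0 1

theorem circleCoeff_eq_integral (φ : ℂ → ℂ) (n : ℤ) : circleCoeff φ n =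
    ∫ t : UnitAddCircle, circlePt t ^ (-n) * φ (circlePt t) ∂haarAddCircle := by
  rw [circleCoeff, ← integral_circlePt]
  simp

theorem differentiableOn_zpow_mul {φ : ℂ → ℂ} (h : DifferentiableOn ℂ φ {0}ᶜ) (n : ℤ) :
    DifferentiableOn ℂ (fun z => z ^ n * φ z) {0}ᶜ :=
  (differentiableOn_zpow n _ (Or.inl (by simp))).mul h

theorem circleCoeff_eq_circleAverage {φ : ℂ → ℂ} (h : DifferentiableOn ℂ φ {0}ᶜ) (n : ℤ) {R : ℝ}
    (hR : 0 < R) : circleCoeff φ n = circleAverage (fun z => z ^ (-n) * φ z) 0 R :=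
  circleAverage_eq_of_differentiableOn (differentiableOn_zpow_mul h _) one_pos hR

theorem circleCoeff_eq_zero_of_differentiable {φ : ℂ → ℂ} (h : Differentiable ℂ φ) {n : ℤ}
    (hn : n < 0) : circleCoeff φ n = 0 := by
  obtain ⟨j, hj⟩ : ∃ j : ℕ, -n = (j + 1 : ℕ) := ⟨(-n).toNat - 1, by omega⟩
  simp only [circleCoeff, hj, zpow_natCast]
  have : Differentiable ℂ fun z : ℂ => z ^ (j + 1) * φ z := by fun_prop
  rw [this.diffContOnCl.circleAverage]
  simp

/-- The part of the Laurent expansion of `φ` with nonnegative exponents, as a Cauchy integral over a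
circle that encloses `z`. The radius `‖z‖ + 1` is one choice; any larger one gives the same
value. -/
def cauchyPart (φ : ℂ → ℂ) (z : ℂ) : ℂ :=
  circleAverage (fun ζ => φ ζ * (ζ / (ζ - z))) 0 (‖z‖ + 1)

theorem cauchyPart_eq_circleAverage {φ : ℂ → ℂ} (h : DifferentiableOn ℂ φ {0}ᶜ) {z : ℂ} {R : ℝ}
    (hR : ‖z‖ < R) : cauchyPart φ z = circleAverage (fun ζ => φ ζ * (ζ / (ζ - z))) 0 R := by
  have key : ∀ {r R : ℝ}, ‖z‖ < r → r ≤ R →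
      circleAverage (fun ζ => φ ζ * (ζ / (ζ - z))) 0 r =
        circleAverage (fun ζ => φ ζ * (ζ / (ζ - z))) 0 R := by
    intro r R hr hle
    have hr0 : 0 < r := (norm_nonneg z).trans_lt hr
    have hd : ∀ ζ : ℂ, r ≤ ‖ζ‖ → DifferentiableAt ℂ (fun ζ => φ ζ * (ζ / (ζ - z))) ζ := by
      intro ζ hζ
      refine DifferentiableAt.mul (h.differentiableAt (isOpen_compl_singleton.mem_nhds ?_))
        (differentiableAt_id.div (differentiableAt_id.sub_const z) ?_)
      · rintro rfl
        simp at hζ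
        linarith
      · intro h0
        have : ζ = z := by simpa [sub_eq_zero] using h0
        subst this
        linarith
    rw [circleAverage_eq_circleIntegral hr0.ne', circleAverage_eq_circleIntegral
      (hr0.trans_le hle).ne',
      Complex.circleIntegral_sub_center_inv_smul_eq_of_differentiable_on_annulus_off_countable hr0
        hle Set.countable_empty]
    · intro ζ hζ
      exact (hd ζ (by simpa using hζ.2)).continuousAt.continuousWithinAt
    · intro ζ hζ
      exact hd ζ (le_of_lt (by simpa using hζ.1.2))
  rw [cauchyPart]
  rcases le_total (‖z‖ + 1) R with hle | hle
  · exact key (by linarith) hle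
  · exact (key hR hle).symm

/-- The Cauchy integral keeps the Laurent coefficients with nonnegative exponents: exchange the
integrals, and apply Cauchy's formula to the kernel. -/
theorem circleCoeff_cauchyPart {φ : ℂ → ℂ} (h : DifferentiableOn ℂ φ {0}ᶜ) {n : ℤ} (hn : 0 ≤ n) :
    circleCoeff (cauchyPart φ) n = circleCoeff φ n := by
  obtain ⟨a, rfl⟩ := Int.eq_ofNat_of_zero_le hn
  have hne : ∀ s t : UnitAddCircle, 2 * circlePt t - circlePt s ≠ 0 := by
    intro s t h0
    have := congrArg norm (sub_eq_zero.1 h0)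
    simp at this
  have hcont : Continuous fun t : UnitAddCircle => φ (2 * circlePt t) := by
    refine h.continuousOn.comp_continuous (by fun_prop) fun t => ?_
    simp
  have inner : ∀ ζ : ℂ, 1 < ‖ζ‖ →
      circleAverage (fun z => z ^ (-(a : ℤ)) * (ζ / (ζ - z))) 0 1 = ζ ^ (-(a : ℤ)) := by
    intro ζ hζ
    have hζ0 : ζ ≠ 0 := by rintro rfl; simp at hζ; linarith
    -- after the substitution `z ↦ z⁻¹` this is Cauchy's formula for `z ^ a` at the point `ζ⁻¹`
    rw [← circleAverage_zero_one_congr_inv]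
    have h1 := DiffContOnCl.circleAverage_smul_div (f := fun z : ℂ => z ^ a) (c := 0) (R := 1)
      (w := ζ⁻¹) (by fun_prop : Differentiable ℂ fun z : ℂ => z ^ a).diffContOnCl (by
        simpa using inv_lt_one_of_one_lt₀ hζ)
    have h2 : ζ ^ (-(a : ℤ)) = ζ⁻¹ ^ a := by simp
    rw [h2, ← h1]
    refine circleAverage_congr_sphere fun z hz => ?_
    have hz1 : ‖z‖ = 1 := by simpa using hz
    have hz0 : z ≠ 0 := by rintro rfl; simp at hz1
    have h3 : ζ * z - 1 ≠ 0 := by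
      intro h0
      have := congrArg norm (sub_eq_zero.1 h0)
      rw [norm_mul, hz1] at this
      simp at this
      linarith
    have h4 : ζ - z⁻¹ ≠ 0 := by
      intro h0; apply h3; field_simp at h0; simpa using h0
    have h5 : z - ζ⁻¹ ≠ 0 := by
      intro h0; apply h3; field_simp at h0; linear_combination h0
    simp only [sub_zero, smul_eq_mul, zpow_neg, zpow_natCast, inv_pow, inv_inv]
    have h6 : ζ / (ζ - z⁻¹) = z / (z - ζ⁻¹) := by
      rw [div_eq_div_iff h4 h5]; field_simp
    rw [h6, mul_comm]
  have lhs : circleCoeff (cauchyPart φ) a = ∫ s : UnitAddCircle, ∫ t : UnitAddCircle,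
      circlePt s ^ (-(a : ℤ)) * (φ (2 * circlePt t) * (2 * circlePt t / (2 * circlePt t - circlePt s)))
        ∂haarAddCircle ∂haarAddCircle := by
    rw [circleCoeff_eq_integral]
    congr 1
    funext s
    rw [integral_const_mul, cauchyPart_eq_circleAverage h (R := 2) (by simp), ← integral_circlePt]
    simp
  rw [lhs, integral_integral_swap]
  · rw [circleCoeff_eq_circleAverage h _ (R := 2) two_pos, ← integral_circlePt]
    congr 1
    funext t
    have h1 := inner (2 * circlePt t) (by simp)
    rw [← integral_circlePt] at h1
    simp only [Complex.ofReal_one, one_mul, Complex.ofReal_ofNat] at h1 ⊢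
    rw [← h1, ← integral_mul_const]
    congr 1
    funext s
    ring
  · refine Continuous.integrable_of_hasCompactSupport ?_ (HasCompactSupport.of_compactSpace _)
    simp only [Function.uncurry_def]
    refine Continuous.mul (Continuous.zpow₀ (by fun_prop) _ fun x => Or.inl (by simp)) ?_
    refine Continuous.mul (hcont.comp continuous_snd) ?_
    exact Continuous.div (by fun_prop) (by fun_prop) fun x => hne _ _

end

/-! ### Laurent coefficients on the torus -/

section

open MeasureTheory AddCircle Real

variable {ι : Type*}

/-- The point of the distinguished torus `|w_i| = 1` in `ℂ^ι` with angles `2πx_i`. -/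
def torusPt (x : ι → UnitAddCircle) : ι → ℂ := fun i => circlePt (x i)

@[fun_prop] theorem continuous_torusPt : Continuous (torusPt : (ι → UnitAddCircle) → ι → ℂ) := by
  unfold torusPt; fun_prop

@[simp] theorem torusPt_apply_ne_zero (x : ι → UnitAddCircle) (i : ι) : torusPt x i ≠ 0 :=
  circlePt_ne_zero _

theorem torusPt_add (x y : ι → UnitAddCircle) : torusPt (x + y) = torusPt x * torusPt y :=
  funext fun _ => circlePt_add _ _

theorem exists_torusPt_eq {u : ι → ℂ} (hu : ∀ i, ‖u i‖ = 1) : ∃ x, torusPt x = u := by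
  choose x hx using fun i => exists_circlePt_eq (hu i)
  exact ⟨x, funext hx⟩

/-- Continuity on the distinguished torus. -/
def ContinuousOnTorus (f : (ι → ℂ) → ℂ) : Prop := Continuous fun x => f (torusPt x)

variable [Fintype ι]

/-- The Laurent monomial `∏_i w_i ^ a_i`. -/
def laurentMonomial (a : ι → ℤ) (w : ι → ℂ) : ℂ := ∏ i, w i ^ a i

/-- The normalised Haar measure on the torus. -/
def torusMeasure (ι : Type*) [Fintype ι] : Measure (ι → UnitAddCircle) :=
  Measure.pi fun _ => haarAddCircle

instance : Measure.IsAddHaarMeasure (torusMeasure ι) := by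
  unfold torusMeasure; infer_instance

instance : IsProbabilityMeasure (torusMeasure ι) := by
  unfold torusMeasure; infer_instance

/-- The Laurent coefficient of `∏_i w_i ^ a_i` in `f`, as an integral over the distinguished
torus. -/
def laurentCoeff (f : (ι → ℂ) → ℂ) (a : ι → ℤ) : ℂ :=
  ∫ x, laurentMonomial (-a) (torusPt x) * f (torusPt x) ∂torusMeasure ι

theorem laurentMonomial_mul (a : ι → ℤ) (v w : ι → ℂ) :
    laurentMonomial a (v * w) = laurentMonomial a v * laurentMonomial a w := by
  simp [laurentMonomial, mul_zpow, Finset.prod_mul_distrib]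

theorem laurentMonomial_neg (a : ι → ℤ) (w : ι → ℂ) :
    laurentMonomial (-a) w = (laurentMonomial a w)⁻¹ := by
  simp [laurentMonomial]

theorem laurentMonomial_ne_zero {a : ι → ℤ} {w : ι → ℂ} (hw : ∀ i, w i ≠ 0) :
    laurentMonomial a w ≠ 0 :=
  Finset.prod_ne_zero_iff.2 fun i _ => zpow_ne_zero _ (hw i)

theorem laurentMonomial_smul (a : ι → ℤ) {t : ℂ} (ht : t ≠ 0) (w : ι → ℂ) :
    laurentMonomial a (t • w) = t ^ (∑ i, a i) * laurentMonomial a w := by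
  have : ∏ i, t ^ a i = t ^ (∑ i, a i) := by
    induction (Finset.univ : Finset ι) using Finset.cons_induction with
    | empty => simp
    | cons i s hi ih => rw [Finset.prod_cons, Finset.sum_cons, zpow_add₀ ht, ih]
  simp [laurentMonomial, mul_zpow, Finset.prod_mul_distrib, this]

theorem continuous_laurentMonomial_torusPt (a : ι → ℤ) :
    Continuous fun x : ι → UnitAddCircle => laurentMonomial a (torusPt x) := by
  refine continuous_finsetProd _ fun i _ => ?_
  refine Continuous.zpow₀ (by fun_prop) _ fun x => Or.inl (by simp)

theorem integrable_of_continuous {X : Type*} [TopologicalSpace X] [CompactSpace X]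
    [MeasurableSpace X] [OpensMeasurableSpace X] {E : Type*} [NormedAddCommGroup E]
    {μ : Measure X} [IsFiniteMeasure μ] [SecondCountableTopologyEither X E] {g : X → E}
    (hg : Continuous g) :
    Integrable g μ :=
  hg.integrable_of_hasCompactSupport (HasCompactSupport.of_compactSpace _)

theorem ContinuousOnTorus.integrable {f : (ι → ℂ) → ℂ} (hf : ContinuousOnTorus f) (a : ι → ℤ) :
    Integrable (fun x => laurentMonomial (-a) (torusPt x) * f (torusPt x)) (torusMeasure ι) :=
  integrable_of_continuous ((continuous_laurentMonomial_torusPt _).mul hf)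

theorem laurentCoeff_congr {f g : (ι → ℂ) → ℂ} (h : ∀ x, f (torusPt x) = g (torusPt x))
    (a : ι → ℤ) : laurentCoeff f a = laurentCoeff g a := by
  simp [laurentCoeff, h]

theorem laurentCoeff_zero (a : ι → ℤ) : laurentCoeff 0 a = 0 := by simp [laurentCoeff]

theorem laurentCoeff_add {f g : (ι → ℂ) → ℂ} (hf : ContinuousOnTorus f) (hg : ContinuousOnTorus g)
    (a : ι → ℤ) : laurentCoeff (f + g) a = laurentCoeff f a + laurentCoeff g a := by
  rw [laurentCoeff, laurentCoeff, laurentCoeff, ← integral_add (hf.integrable a) (hg.integrable a)]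
  simp [mul_add]

theorem laurentCoeff_smul (c : ℂ) (f : (ι → ℂ) → ℂ) (a : ι → ℤ) :
    laurentCoeff (c • f) a = c * laurentCoeff f a := by
  rw [laurentCoeff, laurentCoeff, ← integral_const_mul]
  simp [mul_left_comm]

/-- Laurent coefficients are weight vectors for rotations of the torus. -/
theorem laurentCoeff_mul_left {u : ι → ℂ} (hu : ∀ i, ‖u i‖ = 1) (f : (ι → ℂ) → ℂ) (a : ι → ℤ) :
    laurentCoeff (fun w => f (u * w)) a = laurentMonomial a u * laurentCoeff f a := by
  obtain ⟨y, rfl⟩ := exists_torusPt_eq hu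
  rw [laurentCoeff, laurentCoeff,
    ← integral_add_left_eq_self
      (fun x => laurentMonomial (-a) (torusPt x) * f (torusPt x)) y, ← integral_const_mul]
  congr 1
  funext x
  have h0 : laurentMonomial a (torusPt y) ≠ 0 := laurentMonomial_ne_zero (by simp)
  rw [torusPt_add, laurentMonomial_mul, laurentMonomial_neg a (torusPt y)]
  field_simp

theorem laurentCoeff_laurentMonomial_self (a : ι → ℤ) :
    laurentCoeff (laurentMonomial a) a = 1 := by
  have : ∀ x : ι → UnitAddCircle,
      laurentMonomial (-a) (torusPt x) * laurentMonomial a (torusPt x) = 1 := fun x => by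
    rw [laurentMonomial_neg, inv_mul_cancel₀ (laurentMonomial_ne_zero (by simp))]
  simp [laurentCoeff, this]

/-- The powers of `e^i`, a number on the unit circle which is not a root of unity, are distinct. -/
theorem exists_norm_one_zpow_ne {m n : ℤ} (h : m ≠ n) : ∃ z : ℂ, ‖z‖ = 1 ∧ z ^ m ≠ z ^ n := by
  refine ⟨Complex.exp (Complex.I), by simpa using Complex.norm_exp_ofReal_mul_I 1, ?_⟩
  rw [← Complex.exp_int_mul, ← Complex.exp_int_mul]
  intro he
  obtain ⟨j, hj⟩ := Complex.exp_eq_exp_iff_exists_int.1 he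
  have h1 : (m : ℂ) = n + j * (2 * π) := by
    have := mul_right_cancel₀ Complex.I_ne_zero
      (show (m : ℂ) * Complex.I = (n + j * (2 * π)) * Complex.I by rw [hj]; ring)
    exact this
  have h2 : (m : ℝ) = n + j * (2 * π) := by exact_mod_cast h1
  rcases eq_or_ne j 0 with rfl | hj0
  · apply h
    have : (m : ℝ) = n := by simpa using h2
    exact_mod_cast this
  · have h3 : π = ((m - n : ℤ) : ℚ) / ((2 * j : ℤ) : ℚ) := by
      have : (j : ℝ) ≠ 0 := by exact_mod_cast hj0
      push_cast
      field_simp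
      linarith
    exact irrational_pi ⟨((m - n : ℤ) : ℚ) / ((2 * j : ℤ) : ℚ), by rw [h3]; push_cast; rfl⟩

theorem laurentCoeff_laurentMonomial_of_ne {a b : ι → ℤ} (h : a ≠ b) :
    laurentCoeff (laurentMonomial b) a = 0 := by
  classical
  obtain ⟨i, hi⟩ := Function.ne_iff.1 h
  obtain ⟨z, hz, hne⟩ := exists_norm_one_zpow_ne hi
  have hu : ∀ j, ‖Function.update (1 : ι → ℂ) i z j‖ = 1 := by
    intro j
    rcases eq_or_ne j i with rfl | hj <;> simp [*]
  have hmon : ∀ c : ι → ℤ, laurentMonomial c (Function.update (1 : ι → ℂ) i z) = z ^ c i := by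
    intro c
    rw [laurentMonomial, Finset.prod_eq_single i]
    · simp
    · intro j _ hj
      simp [hj]
    · simp
  have h1 := laurentCoeff_mul_left hu (laurentMonomial b) a
  have h2 : (fun w => laurentMonomial b (Function.update (1 : ι → ℂ) i z * w)) =
      z ^ b i • laurentMonomial b := by
    funext w
    rw [laurentMonomial_mul, hmon]
    rfl
  rw [h2, laurentCoeff_smul, hmon] at h1
  by_contra h0
  exact hne (mul_right_cancel₀ h0 h1).symm

theorem laurentCoeff_laurentMonomial [DecidableEq ι] (a b : ι → ℤ) :
    laurentCoeff (laurentMonomial b) a = if a = b then 1 else 0 := by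
  split_ifs with h
  · rw [h, laurentCoeff_laurentMonomial_self]
  · exact laurentCoeff_laurentMonomial_of_ne h

theorem continuousOnTorus_laurentMonomial (a : ι → ℤ) : ContinuousOnTorus (laurentMonomial a) :=
  continuous_laurentMonomial_torusPt a

/-- A continuous function on the torus all of whose Laurent coefficients vanish is zero. -/
theorem eq_zero_of_laurentCoeff_eq_zero {f : (ι → ℂ) → ℂ} (hf : ContinuousOnTorus f)
    (h : ∀ a, laurentCoeff f a = 0) (x : ι → UnitAddCircle) : f (torusPt x) = 0 := by
  let F : C(UnitAddTorus ι, ℂ) := ⟨fun x => f (torusPt x), hf⟩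
  have hF : UnitAddTorus.mFourierCoeff F = 0 := by
    funext a
    refine Eq.trans ?_ (h a)
    change ∫ t, UnitAddTorus.mFourier (-a) t • F t ∂(torusMeasure ι) = _
    refine congrArg _ (funext fun t => ?_)
    have hm : UnitAddTorus.mFourier (-a) t = laurentMonomial (-a) (torusPt t) :=
      Finset.prod_congr rfl fun i _ => by
        rw [fourier_apply, AddCircle.toCircle_zsmul, Circle.coe_zpow]
        rfl
    rw [hm]
    rfl
  have := UnitAddTorus.hasSum_mFourier_series_apply_of_summable (f := F)
    (by rw [hF]; exact summable_zero) x
  rw [hF] at this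
  simp only [Pi.zero_apply, zero_smul] at this
  exact (hasSum_zero.unique this).symm

section OneVariable

variable [DecidableEq ι]

/-- The integral over the torus may be preceded by an integral over its `i`-th circle, by rotation
invariance and Fubini's theorem. -/
theorem laurentCoeff_eq_integral_circleCoeff {f : (ι → ℂ) → ℂ} (hf : ContinuousOnTorus f)
    (a : ι → ℤ) (i : ι) : laurentCoeff f a = ∫ x : ι → UnitAddCircle,
      laurentMonomial (-a) (torusPt x) * (circlePt (x i) ^ a i *
        circleCoeff (fun z => f (Function.update (torusPt x) i z)) (a i)) ∂torusMeasure ι := by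
  set G : (ι → UnitAddCircle) → ℂ := fun x => laurentMonomial (-a) (torusPt x) * f (torusPt x)
    with hG
  have hGc : Continuous G := (continuous_laurentMonomial_torusPt _).mul hf
  have hupd : ∀ (x : ι → UnitAddCircle) (t : UnitAddCircle),
      Function.update (torusPt x) i (circlePt t) = torusPt (Function.update x i t) := by
    intro x t
    funext j
    rcases eq_or_ne j i with rfl | hj <;> simp [torusPt, *]
  have hmon : ∀ (x : ι → UnitAddCircle) (t : UnitAddCircle),
      laurentMonomial (-a) (torusPt (Function.update x i t)) =
        laurentMonomial (-a) (torusPt x) * (circlePt (x i) ^ a i * circlePt t ^ (-a i)) := by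
    intro x t
    rw [laurentMonomial, laurentMonomial, ← Finset.mul_prod_erase _ _ (Finset.mem_univ i),
      ← Finset.mul_prod_erase _ _ (Finset.mem_univ i),
      Finset.prod_congr rfl (g := fun j => torusPt x j ^ (-a) j)]
    · have h0 := zpow_ne_zero (a i) (circlePt_ne_zero (x i))
      simp only [torusPt, Function.update_self, Pi.neg_apply, zpow_neg]
      field_simp
    · intro j hj
      simp [torusPt, Finset.ne_of_mem_erase hj]
  calc laurentCoeff f a = ∫ x, G x ∂torusMeasure ι := rfl
    _ = ∫ t : UnitAddCircle, ∫ x, G (x + Pi.single i t) ∂torusMeasure ι ∂haarAddCircle := by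
      simp [integral_add_right_eq_self]
    _ = ∫ x, ∫ t : UnitAddCircle, G (x + Pi.single i t) ∂haarAddCircle ∂torusMeasure ι := by
      rw [integral_integral_swap]
      refine integrable_of_continuous ?_
      refine hGc.comp (continuous_snd.add ?_)
      exact (continuous_single i).comp continuous_fst
    _ = ∫ x, ∫ t : UnitAddCircle, G (Function.update x i t) ∂haarAddCircle ∂torusMeasure ι := by
      congr 1
      funext x
      rw [← integral_add_left_eq_self (fun t => G (Function.update x i t)) (x i)]
      congr 1
      funext t
      congr 1
      funext j
      rcases eq_or_ne j i with rfl | hj <;> simp [*]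
    _ = _ := by
      congr 1
      funext x
      rw [circleCoeff_eq_integral, ← integral_const_mul, ← integral_const_mul]
      congr 1
      funext t
      rw [hG]
      simp only [hmon, hupd]
      ring

theorem laurentCoeff_eq_of_circleCoeff_eq {f g : (ι → ℂ) → ℂ} (hf : ContinuousOnTorus f)
    (hg : ContinuousOnTorus g) {a : ι → ℤ} (i : ι)
    (h : ∀ x : ι → UnitAddCircle,
      circleCoeff (fun z => f (Function.update (torusPt x) i z)) (a i) =
        circleCoeff (fun z => g (Function.update (torusPt x) i z)) (a i)) :
    laurentCoeff f a = laurentCoeff g a := by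
  simp only [laurentCoeff_eq_integral_circleCoeff hf a i,
    laurentCoeff_eq_integral_circleCoeff hg a i, h]

end OneVariable

end

/-! ### Holomorphic functions of several variables -/

section

open MeasureTheory AddCircle Real

/-- Integrals of holomorphic functions depending continuously on a parameter in a compact space
are holomorphic. -/
theorem differentiableOn_integral_of_continuousOn {E X : Type*} [NormedAddCommGroup E]
    [NormedSpace ℂ E] [ProperSpace E] [TopologicalSpace X] [CompactSpace X]
    [SecondCountableTopology X] [MeasurableSpace X] [OpensMeasurableSpace X]
    {μ : Measure X} [IsFiniteMeasure μ] {U : Set E} (hU : IsOpen U) {H : E → X → ℂ}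
    (hd : ∀ t, DifferentiableOn ℂ (fun w => H w t) U)
    (hc : ContinuousOn (Function.uncurry H) (U ×ˢ Set.univ)) :
    DifferentiableOn ℂ (fun w => ∫ t, H w t ∂μ) U := by
  intro w₀ hw₀
  obtain ⟨r, hr, hrU⟩ := Metric.nhds_basis_closedBall.mem_iff.1 (hU.mem_nhds hw₀)
  have hball : Metric.ball w₀ r ⊆ U := Metric.ball_subset_closedBall.trans hrU
  have hK : IsCompact (Metric.closedBall w₀ r ×ˢ (Set.univ : Set X)) :=
    (isCompact_closedBall w₀ r).prod isCompact_univ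
  have hcK := hc.mono (Set.prod_mono hrU (Set.Subset.refl (Set.univ : Set X)))
  obtain ⟨M, hM⟩ := hK.exists_bound_of_continuousOn hcK
  have hcont : ∀ w ∈ U, Continuous (H w) := fun w hw =>
    hc.comp_continuous (f := fun t => (w, t)) (by fun_prop) fun t => ⟨hw, trivial⟩
  have hw₀' : w₀ ∈ Metric.closedBall w₀ r := Metric.mem_closedBall_self hr.le
  have hderiv : Continuous fun t => fderiv ℂ (fun w => H w t) w₀ := by
    rw [continuous_iff_continuousAt]
    intro s
    -- by the Schwarz lemma, uniform closeness of the functions gives closeness of derivatives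
    rw [ContinuousAt, Metric.tendsto_nhds]
    intro ε hε
    have hunif : ∀ᶠ t in 𝓝 s, ∀ w ∈ Metric.closedBall w₀ r, dist (H w t) (H w s) < ε * r / 4 := by
      obtain ⟨v, hv, hv'⟩ := (isCompact_closedBall w₀ r).mem_uniformity_of_prod
        (f := fun t w => H w t) (s := Set.univ) (q := s)
        (hcK.comp continuous_swap.continuousOn fun p hp => ⟨hp.2, trivial⟩) trivial
        (Metric.dist_mem_uniformity (show 0 < ε * r / 4 by positivity))
      rw [nhdsWithin_univ] at hv
      filter_upwards [hv] with t ht w hw using hv' t ht w hw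
    filter_upwards [hunif] with t ht
    have hdt := (hd t).mono hball
    have hds := (hd s).mono hball
    have h1 := Complex.norm_fderiv_le_div_of_mapsTo_ball (f := fun w => H w t - H w s)
      (R₂ := ε * r / 2) (hdt.sub hds) (fun w hw => ?_) hr
    · rw [dist_eq_norm]
      have hnh := Metric.ball_mem_nhds w₀ hr
      rw [fderiv_fun_sub (hdt.differentiableAt hnh) (hds.differentiableAt hnh)] at h1
      refine h1.trans_lt ?_
      rw [div_lt_iff₀ hr]
      nlinarith
    · have ha := ht w (Metric.ball_subset_closedBall hw)
      have hb := ht w₀ hw₀'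
      rw [dist_eq_norm] at ha hb
      rw [Metric.mem_closedBall, dist_eq_norm]
      refine (norm_sub_le _ _).trans ?_
      linarith
  refine (hasFDerivAt_integral_of_dominated_loc_of_lip' (s := Metric.ball w₀ r)
    (bound := fun _ => 2 * M / r) (F' := fun t => fderiv ℂ (fun w => H w t) w₀)
    (Metric.ball_mem_nhds w₀ hr) (fun w hw => ?_) ?_ ?_ ?_ (integrable_const _)
    ?_).2.differentiableAt.differentiableWithinAt
  · exact (hcont w (hball hw)).aestronglyMeasurable
  · exact integrable_of_continuous (hcont w₀ hw₀)
  · exact hderiv.aestronglyMeasurable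
  · refine Filter.Eventually.of_forall fun t w hw => ?_
    have h1 := Complex.dist_le_div_mul_dist_of_mapsTo_ball (f := fun w => H w t) (R₂ := 2 * M)
      ((hd t).mono hball) (fun v hv => ?_) hw
    · simpa [dist_eq_norm] using h1
    · have ha := hM (v, t) ⟨Metric.ball_subset_closedBall hv, trivial⟩
      have hb := hM (w₀, t) ⟨hw₀', trivial⟩
      rw [Metric.mem_closedBall, dist_eq_norm]
      refine (norm_sub_le _ _).trans ?_
      simp only [Function.uncurry_apply_pair] at ha hb
      linarith
  · exact Filter.Eventually.of_forall fun t =>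
      (((hd t).mono hball).differentiableAt (Metric.ball_mem_nhds w₀ hr)).hasFDerivAt

variable {ι : Type*}

/-- The open set of points of `ℂ^ι` whose coordinates with index in `S` do not vanish. -/
def nonvanishing (S : Finset ι) : Set (ι → ℂ) := {w | ∀ i ∈ S, w i ≠ 0}

theorem isOpen_nonvanishing (S : Finset ι) : IsOpen (nonvanishing S) := by
  have : nonvanishing S = ⋂ i ∈ S, {w : ι → ℂ | w i ≠ 0} := by
    ext w; simp [nonvanishing]
  rw [this]
  exact isOpen_biInter_finset fun i _ => isOpen_ne_fun (continuous_apply i) continuous_const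

theorem nonvanishing_anti {S T : Finset ι} (h : S ⊆ T) : nonvanishing T ⊆ nonvanishing S :=
  fun _ hw i hi => hw i (h hi)

theorem torusPt_mem_nonvanishing (S : Finset ι) (x : ι → UnitAddCircle) :
    torusPt x ∈ nonvanishing S := fun i _ => torusPt_apply_ne_zero x i

theorem update_mem_nonvanishing [DecidableEq ι] {S : Finset ι} {w : ι → ℂ} {i : ι}
    (hw : w ∈ nonvanishing (S.erase i)) {z : ℂ} (hz : i ∈ S → z ≠ 0) :
    Function.update w i z ∈ nonvanishing S := by
  intro j hj
  rcases eq_or_ne j i with rfl | hji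
  · simpa using hz hj
  · simpa [hji] using hw j (Finset.mem_erase.2 ⟨hji, hj⟩)

theorem smul_mem_nonvanishing {S : Finset ι} {t : ℂ} (ht : t ≠ 0) {w : ι → ℂ}
    (hw : w ∈ nonvanishing S) : t • w ∈ nonvanishing S := fun i hi => mul_ne_zero ht (hw i hi)

theorem ContinuousOnTorus.of_differentiableOn {S : Finset ι} {f : (ι → ℂ) → ℂ}
    (hf : DifferentiableOn ℂ f (nonvanishing S)) : ContinuousOnTorus f :=
  hf.continuousOn.comp_continuous continuous_torusPt (torusPt_mem_nonvanishing S)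

theorem differentiable_update [DecidableEq ι] (w : ι → ℂ) (i : ι) :
    Differentiable ℂ fun z : ℂ => Function.update w i z := by
  rw [differentiable_pi]
  intro j
  rcases eq_or_ne j i with rfl | hji
  · simp
  · simp [hji]

variable [Fintype ι]

section Slices

variable [DecidableEq ι]

theorem differentiableOn_slice {S : Finset ι} {f : (ι → ℂ) → ℂ}
    (hf : DifferentiableOn ℂ f (nonvanishing S)) {i : ι} {w : ι → ℂ}
    (hw : w ∈ nonvanishing (S.erase i)) :
    DifferentiableOn ℂ (fun z => f (Function.update w i z)) {0}ᶜ :=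
  hf.comp (differentiable_update w i).differentiableOn fun _ hz =>
    update_mem_nonvanishing hw fun _ => hz

theorem differentiable_slice {S : Finset ι} {f : (ι → ℂ) → ℂ}
    (hf : DifferentiableOn ℂ f (nonvanishing S)) {i : ι} (hi : i ∉ S) {w : ι → ℂ}
    (hw : w ∈ nonvanishing S) :
    Differentiable ℂ (fun z => f (Function.update w i z)) := by
  rw [← differentiableOn_univ]
  refine hf.comp (differentiable_update w i).differentiableOn fun _ _ =>
    update_mem_nonvanishing (nonvanishing_anti (Finset.erase_subset _ _) hw) fun h => (hi h).elim

/-- A function which is holomorphic across `w_i = 0` has no Laurent terms with a negative power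
of `w_i`. -/
theorem laurentCoeff_eq_zero_of_neg {S : Finset ι} {f : (ι → ℂ) → ℂ}
    (hf : DifferentiableOn ℂ f (nonvanishing S)) {i : ι} (hi : i ∉ S) {a : ι → ℤ} (ha : a i < 0) :
    laurentCoeff f a = 0 := by
  rw [laurentCoeff_eq_integral_circleCoeff (ContinuousOnTorus.of_differentiableOn hf) a i]
  have : ∀ x : ι → UnitAddCircle,
      circleCoeff (fun z => f (Function.update (torusPt x) i z)) (a i) = 0 := fun x =>
    circleCoeff_eq_zero_of_differentiable
      (differentiable_slice hf hi (torusPt_mem_nonvanishing S x)) ha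
  simp [this]

end Slices

/-- The unit circle accumulates at `1`, so the identity theorem applies on `ℂ ∖ {0}`; the value at
the origin, if it belongs to the domain, follows by continuity. -/
theorem eq_zero_of_eq_zero_on_circle {g : ℂ → ℂ} {D : Set ℂ} (hD : IsOpen D) (hD' : {0}ᶜ ⊆ D)
    (hg : DifferentiableOn ℂ g D) (h : ∀ z, ‖z‖ = 1 → g z = 0) : ∀ z ∈ D, g z = 0 := by
  have h1 : ∀ z : ℂ, z ≠ 0 → g z = 0 := by
    have hfreq : ∃ᶠ z in 𝓝[≠] (1 : ℂ), g z = 0 := by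
      have ht : Filter.Tendsto (fun θ : ℝ => Complex.exp (θ * Complex.I)) (𝓝[≠] 0) (𝓝[≠] 1) := by
        refine tendsto_nhdsWithin_iff.2 ⟨?_, ?_⟩
        · have : Continuous fun θ : ℝ => Complex.exp (θ * Complex.I) := by fun_prop
          have := this.tendsto 0
          simp only [Complex.ofReal_zero, zero_mul, Complex.exp_zero] at this
          exact this.mono_left nhdsWithin_le_nhds
        · have hlt : ∀ᶠ θ : ℝ in 𝓝[≠] 0, |θ| < 2 * π :=
            nhdsWithin_le_nhds (Metric.eventually_nhds_iff.2
              ⟨2 * π, by positivity, fun y hy => by simpa [Real.dist_eq] using hy⟩)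
          filter_upwards [hlt, self_mem_nhdsWithin] with θ hθ hθ0 h1
          obtain ⟨n, hn⟩ := Complex.exp_eq_one_iff.1 h1
          have h2 : (θ : ℂ) = n * (2 * π) :=
            mul_right_cancel₀ Complex.I_ne_zero (by rw [hn]; ring)
          have h3 : θ = n * (2 * π) := by exact_mod_cast h2
          rcases eq_or_ne n 0 with rfl | hn0
          · simp at h3; exact hθ0 h3
          · have h4 : (1 : ℝ) ≤ |(n : ℝ)| := by exact_mod_cast Int.one_le_abs hn0
            rw [h3, abs_mul, abs_of_pos (by positivity : (0 : ℝ) < 2 * π)] at hθ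
            nlinarith [Real.pi_pos]
      refine ht.frequently (Filter.Eventually.frequently (Filter.Eventually.of_forall fun θ => ?_))
      exact h _ (Complex.norm_exp_ofReal_mul_I θ)
    have hopen : IsOpen ({0}ᶜ : Set ℂ) := isOpen_compl_singleton
    intro z hz
    exact ((hg.mono hD').analyticOnNhd hopen).eqOn_zero_of_preconnected_of_frequently_eq_zero
      (isConnected_compl_singleton_of_one_lt_rank (by simp) 0).isPreconnected
      (show (1 : ℂ) ∈ ({0}ᶜ : Set ℂ) by simp) hfreq hz
  intro z hz
  rcases eq_or_ne z 0 with rfl | hz0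
  · have hcont : ContinuousAt g 0 := (hg.continuousOn).continuousAt (hD.mem_nhds hz)
    have h2 : Filter.Tendsto g (𝓝[≠] 0) (𝓝 (g 0)) := hcont.tendsto.mono_left nhdsWithin_le_nhds
    have h3 : Filter.Tendsto g (𝓝[≠] 0) (𝓝 0) := tendsto_const_nhds.congr'
      (Filter.eventually_of_mem self_mem_nhdsWithin fun z hz => (h1 z hz).symm)
    exact tendsto_nhds_unique h2 h3
  · exact h1 z hz0

/-- The distinguished torus is a set of uniqueness for holomorphic functions. -/
theorem eq_zero_of_eq_zero_on_torus {S : Finset ι} {f : (ι → ℂ) → ℂ}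
    (hf : DifferentiableOn ℂ f (nonvanishing S)) (h : ∀ x, f (torusPt x) = 0) :
    ∀ w ∈ nonvanishing S, f w = 0 := by
  classical
  -- one after the other, the coordinates are allowed to leave the unit circle
  have key : ∀ J : Finset ι, ∀ w ∈ nonvanishing S, (∀ i ∉ J, ‖w i‖ = 1) → f w = 0 := by
    intro J
    induction J using Finset.induction_on with
    | empty =>
      intro w _ hw
      obtain ⟨x, rfl⟩ := exists_torusPt_eq fun i => hw i (by simp)
      exact h x
    | insert i J hi ih =>
      intro w hwS hw
      have hw' := nonvanishing_anti (Finset.erase_subset i S) hwS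
      have := eq_zero_of_eq_zero_on_circle (g := fun z => f (Function.update w i z))
        (D := {z | i ∈ S → z ≠ 0}) ?_ (fun z hz _ => hz) ?_ ?_ (w i) (hwS i)
      · simpa using this
      · by_cases hiS : i ∈ S
        · simp only [hiS, true_imp_iff]
          exact isOpen_compl_singleton
        · simp [hiS]
      · exact hf.comp (differentiable_update w i).differentiableOn fun z hz =>
          update_mem_nonvanishing hw' hz
      · intro z hz
        refine ih _ (update_mem_nonvanishing hw' fun _ => ?_) fun j hj => ?_
        · rintro rfl; simp at hz
        · rcases eq_or_ne j i with rfl | hji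
          · simpa using hz
          · simpa [hji] using hw j (by simp [hji, hj])
  intro w hw
  exact key Finset.univ w hw (by simp)

theorem eqOn_of_laurentCoeff_eq {S : Finset ι} {f g : (ι → ℂ) → ℂ}
    (hf : DifferentiableOn ℂ f (nonvanishing S)) (hg : DifferentiableOn ℂ g (nonvanishing S))
    (h : ∀ a, laurentCoeff f a = laurentCoeff g a) : Set.EqOn f g (nonvanishing S) := by
  intro w hw
  have hfg := hf.add (hg.const_smul (-1 : ℂ))
  have := eq_zero_of_eq_zero_on_torus hfg
    (eq_zero_of_laurentCoeff_eq_zero (ContinuousOnTorus.of_differentiableOn hfg) fun a => ?_) w hw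
  · simpa [add_neg_eq_zero] using this
  · rw [laurentCoeff_add (ContinuousOnTorus.of_differentiableOn hf)
      (ContinuousOnTorus.of_differentiableOn (hg.const_smul (-1 : ℂ))), laurentCoeff_smul, h]
    ring

theorem laurentCoeff_smul_arg {t : ℂ} (ht : ‖t‖ = 1) (f : (ι → ℂ) → ℂ) (a : ι → ℤ) :
    laurentCoeff (fun w => f (t • w)) a = t ^ (∑ i, a i) * laurentCoeff f a := by
  have ht0 : t ≠ 0 := by rintro rfl; simp at ht
  have h1 := laurentCoeff_mul_left (u := t • (1 : ι → ℂ)) (by simp [ht]) f a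
  rw [laurentMonomial_smul a ht0] at h1
  have h2 : laurentMonomial a (1 : ι → ℂ) = 1 := by simp [laurentMonomial]
  rw [h2, mul_one] at h1
  rw [← h1]
  congr 1
  funext w
  rw [smul_mul_assoc, one_mul]

/-- Only monomials of degree `m` occur in a function which is homogeneous of degree `m`. -/
theorem laurentCoeff_eq_zero_of_homogeneous {m : ℤ} {f : (ι → ℂ) → ℂ}
    (h : ∀ t : ℂ, t ≠ 0 → ∀ x, f (t • torusPt x) = t ^ m * f (torusPt x)) {a : ι → ℤ}
    (ha : ∑ i, a i ≠ m) : laurentCoeff f a = 0 := by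
  obtain ⟨t, ht, hne⟩ := exists_norm_one_zpow_ne ha
  have ht0 : t ≠ 0 := by rintro rfl; simp at ht
  have h1 := laurentCoeff_smul_arg ht f a
  rw [laurentCoeff_congr (g := t ^ m • f) (fun x => h t ht0 x), laurentCoeff_smul] at h1
  by_contra h0
  exact hne (mul_right_cancel₀ h0 h1).symm

/-- A function with monomials of degree `m` only is homogeneous of degree `m`: for scalars on the
unit circle by uniqueness of Laurent expansions, and then for all by the identity theorem. -/
theorem homogeneous_of_laurentCoeff_eq_zero {S : Finset ι} {m : ℤ} {f : (ι → ℂ) → ℂ}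
    (hf : DifferentiableOn ℂ f (nonvanishing S))
    (h : ∀ a : ι → ℤ, ∑ i, a i ≠ m → laurentCoeff f a = 0) {t : ℂ} (ht : t ≠ 0) {w : ι → ℂ}
    (hw : w ∈ nonvanishing S) : f (t • w) = t ^ m * f w := by
  have hsmul : ∀ s : ℂ, s ≠ 0 → DifferentiableOn ℂ (fun w => f (s • w)) (nonvanishing S) :=
    fun s hs => hf.comp (differentiable_id.const_smul s).differentiableOn
      fun v hv => smul_mem_nonvanishing hs hv
  have hunit : ∀ s : ℂ, ‖s‖ = 1 → f (s • w) = s ^ m * f w := by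
    intro s hs
    have hs0 : s ≠ 0 := by rintro rfl; simp at hs
    refine eqOn_of_laurentCoeff_eq (g := s ^ m • f) (hsmul s hs0) (hf.const_smul _)
      (fun a => ?_) hw
    rw [laurentCoeff_smul_arg hs, laurentCoeff_smul]
    by_cases ha : ∑ i, a i = m
    · rw [ha]
    · rw [h a ha, mul_zero, mul_zero]
  have := eq_zero_of_eq_zero_on_circle (g := fun s => f (s • w) - s ^ m * f w) (D := {0}ᶜ)
    isOpen_compl_singleton Set.Subset.rfl ?_ (fun s hs => sub_eq_zero.2 (hunit s hs)) t ht
  · exact sub_eq_zero.1 this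
  · refine DifferentiableOn.sub ?_ ?_
    · exact hf.comp (differentiable_id.smul_const w).differentiableOn
        fun s hs => smul_mem_nonvanishing hs hw
    · exact (differentiableOn_zpow m _ (Or.inl (by simp))).mul_const _

/-- The part of the Laurent expansion of a holomorphic function with nonnegative powers of `w_i` is
holomorphic across `w_i = 0`. -/
theorem exists_nonnegative_part [DecidableEq ι] {T : Finset ι} {i : ι} {f : (ι → ℂ) → ℂ}
    (hf : DifferentiableOn ℂ f (nonvanishing T)) :
    ∃ g : (ι → ℂ) → ℂ, DifferentiableOn ℂ g (nonvanishing (T.erase i)) ∧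
      ∀ a : ι → ℤ, laurentCoeff g a = if 0 ≤ a i then laurentCoeff f a else 0 := by
  let g : (ι → ℂ) → ℂ := fun w => cauchyPart (fun z => f (Function.update w i z)) (w i)
  have hslice : ∀ w ∈ nonvanishing (T.erase i),
      DifferentiableOn ℂ (fun z => f (Function.update w i z)) {0}ᶜ :=
    fun w hw => differentiableOn_slice hf hw
  have hg : DifferentiableOn ℂ g (nonvanishing (T.erase i)) := by
    intro w₀ hw₀
    -- near `w₀`, the radius of the Cauchy integral can be kept fixed
    set R : ℝ := ‖w₀ i‖ + 1 with hR
    have hRpos : 0 < R := by positivity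
    set U : Set (ι → ℂ) := nonvanishing (T.erase i) ∩ {w | ‖w i‖ < R} with hUdef
    have hU : IsOpen U := (isOpen_nonvanishing _).inter
      (isOpen_lt (by fun_prop) continuous_const)
    have hw₀U : w₀ ∈ U := ⟨hw₀, by simp [hR]⟩
    have hne : ∀ t : UnitAddCircle, ∀ w ∈ U, R * circlePt t - w i ≠ 0 := by
      intro t w hw h0
      have h1 := congrArg norm (sub_eq_zero.1 h0)
      have h2 : ‖w i‖ < R := hw.2
      rw [norm_mul, norm_circlePt, Complex.norm_real, Real.norm_of_nonneg hRpos.le] at h1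
      linarith
    have hR0 : (R : ℂ) ≠ 0 := by exact_mod_cast hRpos.ne'
    have hmem : ∀ t : UnitAddCircle, ∀ w ∈ U,
        Function.update w i (R * circlePt t) ∈ nonvanishing T := fun t w hw =>
      update_mem_nonvanishing hw.1 fun _ => mul_ne_zero hR0 (circlePt_ne_zero t)
    have hint : DifferentiableOn ℂ (fun w => ∫ t : UnitAddCircle,
        f (Function.update w i (R * circlePt t)) *
          (R * circlePt t / (R * circlePt t - w i)) ∂haarAddCircle) U := by
      refine differentiableOn_integral_of_continuousOn hU (fun t => ?_) ?_
      · refine DifferentiableOn.mul ?_ ?_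
        · refine hf.comp (DifferentiableOn.mono ?_ (Set.subset_univ U)) (hmem t)
          rw [differentiableOn_univ, differentiable_pi]
          intro j
          rcases eq_or_ne j i with rfl | hji
          · simp
          · simpa [hji] using differentiable_apply (𝕜 := ℂ) j
        · have h1 : DifferentiableOn ℂ (fun w : ι → ℂ => (R : ℂ) * circlePt t - w i) U :=
            ((differentiable_apply i).const_sub _).differentiableOn
          simp only [div_eq_mul_inv]
          exact (h1.fun_inv (hne t)).const_mul _
      · refine ContinuousOn.mul ?_ ?_
        · refine hf.continuousOn.comp (f := fun p : (ι → ℂ) × UnitAddCircle =>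
            Function.update p.1 i (R * circlePt p.2)) ?_ fun p hp => hmem p.2 p.1 hp.1
          exact (continuous_fst.update i (by fun_prop)).continuousOn
        · exact ContinuousOn.div (by fun_prop) (by fun_prop) fun p hp => hne p.2 p.1 hp.1
    refine ((hint.differentiableAt (hU.mem_nhds hw₀U)).congr_of_eventuallyEq
      ?_).differentiableWithinAt
    filter_upwards [hU.mem_nhds hw₀U] with w hw
    rw [integral_circlePt (fun ζ => f (Function.update w i ζ) * (ζ / (ζ - w i)))]
    exact cauchyPart_eq_circleAverage (hslice w hw.1) hw.2
  refine ⟨g, hg, fun a => ?_⟩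
  split_ifs with ha
  · refine laurentCoeff_eq_of_circleCoeff_eq (ContinuousOnTorus.of_differentiableOn hg)
      (ContinuousOnTorus.of_differentiableOn hf) i fun x => ?_
    rw [← circleCoeff_cauchyPart (hslice _ (torusPt_mem_nonvanishing _ x)) ha]
    simp [g]
  · exact laurentCoeff_eq_zero_of_neg hg (by simp) (not_le.1 ha)

end

/-! ### The Čech complex in terms of Laurent coefficients -/

section

theorem cone_chartInter {k : ℕ} {S : Finset (Fin (k + 1))} (hS : S.Nonempty) :
    cone (chartInter S) = nonvanishing S := by
  ext w
  rw [mem_cone_chartInter]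
  obtain ⟨i, hi⟩ := hS
  exact ⟨fun h => h.2, fun h => ⟨fun h0 => h i hi (congrFun h0 i), h⟩⟩

theorem holSections_differentiableOn {k : ℕ} {m : ℤ} {S : Finset (Fin (k + 1))} (hS : S.Nonempty)
    (s : holSections k m (chartInter S)) : DifferentiableOn ℂ s.1 (nonvanishing S) :=
  cone_chartInter hS ▸ s.2.1

/-- A holomorphic function on `{w | ∀ i ∈ S, w i ≠ 0}`, all of whose Laurent monomials have degree
`m`, as a section of `𝒪(m)`. -/
def sectionOfCoeff {k : ℕ} (m : ℤ) {S : Finset (Fin (k + 1))} (hS : S.Nonempty)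
    (g : (Fin (k + 1) → ℂ) → ℂ) (hg : DifferentiableOn ℂ g (nonvanishing S))
    (hm : ∀ a : Fin (k + 1) → ℤ, ∑ i, a i ≠ m → laurentCoeff g a = 0) :
    holSections k m (chartInter S) :=
  ⟨(nonvanishing S).indicator g, by
    rw [holSections, Submodule.mem_mk, AddSubmonoid.mem_mk, AddSubsemigroup.mem_mk,
      Set.mem_ofPred_eq, cone_chartInter hS]
    refine ⟨hg.congr fun w hw => Set.indicator_of_mem hw _, fun t ht w hw => ?_,
      fun w hw => Set.indicator_of_notMem hw _⟩
    rw [Set.indicator_of_mem hw, Set.indicator_of_mem (smul_mem_nonvanishing ht hw)]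
    exact homogeneous_of_laurentCoeff_eq_zero hg hm ht hw⟩

theorem laurentCoeff_sectionOfCoeff {k : ℕ} (m : ℤ) {S : Finset (Fin (k + 1))} (hS : S.Nonempty)
    (g : (Fin (k + 1) → ℂ) → ℂ) (hg : DifferentiableOn ℂ g (nonvanishing S))
    (hm : ∀ a : Fin (k + 1) → ℤ, ∑ i, a i ≠ m → laurentCoeff g a = 0) (a : Fin (k + 1) → ℤ) :
    laurentCoeff (sectionOfCoeff m hS g hg hm).1 a = laurentCoeff g a :=
  laurentCoeff_congr (fun x => Set.indicator_of_mem (torusPt_mem_nonvanishing S x) _) a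

theorem nonempty_of_card_eq_succ {α : Type*} {S : Finset α} {p : ℕ} (h : S.card = p + 1) :
    S.Nonempty := Finset.card_pos.1 (by omega)

variable {k : ℕ} {m : ℤ} {p : ℕ}

/-- The Laurent coefficients of the components of a Čech cochain; by convention they are zero for
sets `S` of the wrong size. -/
def cochainCoeff (S : Finset (Fin (k + 1))) (a : Fin (k + 1) → ℤ) : Cochains k m p →ₗ[ℂ] ℂ where
  toFun f := if h : S.card = p + 1 then laurentCoeff (f ⟨S, h⟩).1 a else 0
  map_add' f g := by
    split_ifs with h
    · have hS := nonempty_of_card_eq_succ h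
      exact laurentCoeff_add (.of_differentiableOn (holSections_differentiableOn hS (f ⟨S, h⟩)))
        (.of_differentiableOn (holSections_differentiableOn hS (g ⟨S, h⟩))) a
    · simp
  map_smul' c f := by
    split_ifs with h
    · exact laurentCoeff_smul c (f ⟨S, h⟩).1 a
    · simp

theorem cochainCoeff_of_card {S : Finset (Fin (k + 1))} (h : S.card = p + 1)
    (a : Fin (k + 1) → ℤ) (f : Cochains k m p) :
    cochainCoeff S a f = laurentCoeff (f ⟨S, h⟩).1 a := dif_pos h

theorem cochainCoeff_of_card_ne {S : Finset (Fin (k + 1))} (h : S.card ≠ p + 1)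
    (a : Fin (k + 1) → ℤ) (f : Cochains k m p) : cochainCoeff S a f = 0 := dif_neg h

theorem cochain_ext {f g : Cochains k m p} (h : ∀ S a, cochainCoeff S a f = cochainCoeff S a g) :
    f = g := by
  funext S
  have hS := nonempty_of_card_eq_succ S.2
  apply Subtype.ext
  funext w
  by_cases hw : w ∈ nonvanishing S.1
  · refine eqOn_of_laurentCoeff_eq (holSections_differentiableOn hS _)
      (holSections_differentiableOn hS _) (fun a => ?_) hw
    simpa only [cochainCoeff_of_card S.2] using h S.1 a
  · rw [← cone_chartInter hS] at hw
    rw [(f S).2.2.2 w hw, (g S).2.2.2 w hw]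

theorem cochainCoeff_eq_zero_of_neg (f : Cochains k m p) {S : Finset (Fin (k + 1))}
    {a : Fin (k + 1) → ℤ} {i : Fin (k + 1)} (hi : i ∉ S) (ha : a i < 0) :
    cochainCoeff S a f = 0 := by
  by_cases h : S.card = p + 1
  · rw [cochainCoeff_of_card h]
    exact laurentCoeff_eq_zero_of_neg
      (holSections_differentiableOn (nonempty_of_card_eq_succ h) _) hi ha
  · exact cochainCoeff_of_card_ne h a f

theorem cochainCoeff_eq_zero_of_sum_ne (f : Cochains k m p) (S : Finset (Fin (k + 1)))
    {a : Fin (k + 1) → ℤ} (ha : ∑ i, a i ≠ m) : cochainCoeff S a f = 0 := by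
  by_cases h : S.card = p + 1
  · rw [cochainCoeff_of_card h]
    refine laurentCoeff_eq_zero_of_homogeneous (fun t ht x => ?_) ha
    refine (f ⟨S, h⟩).2.2.1 t ht _ ?_
    rw [cone_chartInter (nonempty_of_card_eq_succ h)]
    exact torusPt_mem_nonvanishing S x
  · exact cochainCoeff_of_card_ne h a f

theorem laurentCoeff_sum {ι κ : Type*} [Fintype ι] (s : Finset κ) {F : κ → (ι → ℂ) → ℂ}
    (hF : ∀ i ∈ s, ContinuousOnTorus (F i)) (a : ι → ℤ) :
    laurentCoeff (∑ i ∈ s, F i) a = ∑ i ∈ s, laurentCoeff (F i) a := by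
  simp only [laurentCoeff, ← MeasureTheory.integral_finsetSum s fun i hi => (hF i hi).integrable a]
  simp [Finset.mul_sum]

/-- The sign of the face map omitting `i` from `S`. -/
def faceSign {k : ℕ} (i : Fin (k + 1)) (S : Finset (Fin (k + 1))) : ℂ :=
  (-1) ^ (S.filter (fun j => j < i)).card

theorem faceSign_mul_self {k : ℕ} (i : Fin (k + 1)) (S : Finset (Fin (k + 1))) :
    faceSign i S * faceSign i S = 1 := by
  rw [faceSign, ← pow_add, Even.neg_one_pow ⟨_, rfl⟩]

theorem faceSign_insert {k : ℕ} (i j : Fin (k + 1)) {S : Finset (Fin (k + 1))} (hj : j ∉ S) :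
    faceSign i (insert j S) = if j < i then -faceSign i S else faceSign i S := by
  rw [faceSign, faceSign, Finset.filter_insert]
  split_ifs with h
  · rw [Finset.card_insert_of_notMem (by simp [hj]), pow_succ]; ring
  · rfl

theorem faceSign_insert_self {k : ℕ} (i : Fin (k + 1)) {S : Finset (Fin (k + 1))} (hi : i ∉ S) :
    faceSign i (insert i S) = faceSign i S := by
  simp [faceSign_insert i i hi]

theorem faceSign_erase_self {k : ℕ} (i : Fin (k + 1)) {S : Finset (Fin (k + 1))} (hi : i ∈ S) :
    faceSign i (S.erase i) = faceSign i S := by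
  conv_rhs => rw [← Finset.insert_erase hi]
  rw [faceSign_insert_self i (Finset.notMem_erase i S)]

/-- Inserting `i` anticommutes with omitting `j`. -/
theorem faceSign_mul_faceSign_insert {k : ℕ} {i j : Fin (k + 1)} {S : Finset (Fin (k + 1))}
    (hi : i ∉ S) (hj : j ∈ S) :
    faceSign i S * faceSign j (insert i S) = -(faceSign j S * faceSign i (S.erase j)) := by
  have hij : i ≠ j := by rintro rfl; exact hi hj
  obtain ⟨R, hR, rfl⟩ : ∃ R, j ∉ R ∧ S = insert j R :=
    ⟨S.erase j, Finset.notMem_erase j S, (Finset.insert_erase hj).symm⟩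
  rw [Finset.erase_insert hR, faceSign_insert j i hi, faceSign_insert i j hR]
  rcases lt_or_gt_of_ne hij with h | h
  · simp [h, h.not_gt]; ring
  · simp [h, h.not_gt]; ring

/-- Omissions of two indices anticommute. -/
theorem faceSign_mul_faceSign_erase {k : ℕ} {i j : Fin (k + 1)} {S : Finset (Fin (k + 1))}
    (hi : i ∈ S) (hj : j ∈ S) (hij : i ≠ j) :
    faceSign i S * faceSign j (S.erase i) = -(faceSign j S * faceSign i (S.erase j)) := by
  have h := faceSign_mul_faceSign_insert (i := i) (j := j) (Finset.notMem_erase i S)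
    (Finset.mem_erase.2 ⟨hij.symm, hj⟩)
  have hi' : i ∈ S.erase j := Finset.mem_erase.2 ⟨hij, hi⟩
  rw [Finset.insert_erase hi, faceSign_erase_self i hi, Finset.erase_right_comm,
    faceSign_erase_self i hi'] at h
  linear_combination (faceSign j S * faceSign j (S.erase i)) * h -
    (faceSign i S * faceSign j (S.erase i)) * faceSign_mul_self j S -
    (faceSign j S * faceSign i (S.erase j)) * faceSign_mul_self j (S.erase i)

theorem cochainCoeff_cechD (f : Cochains k m p) (S : Finset (Fin (k + 1)))
    (a : Fin (k + 1) → ℤ) :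
    cochainCoeff S a (cechD k m p f) =
      ∑ i ∈ S, faceSign i S * cochainCoeff (S.erase i) a f := by
  by_cases h : S.card = p + 1 + 1
  · have hcard : ∀ i ∈ S, (S.erase i).card = p + 1 := fun i hi => by
      rw [Finset.card_erase_of_mem hi, h]; rfl
    have hS := nonempty_of_card_eq_succ h
    rw [cochainCoeff_of_card h, ← Finset.sum_coe_sort]
    have hval : ((cechD k m p f) ⟨S, h⟩).1 = ∑ i : {i // i ∈ S}, faceSign i.1 S •
        (cone (chartInter S)).indicator (f ⟨S.erase i.1, hcard i.1 i.2⟩).1 := by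
      change (Submodule.subtype _) (∑ i : {i // i ∈ S}, _) = _
      rw [map_sum]
      rfl
    have hind : ∀ (i : {i // i ∈ S}) (x : Fin (k + 1) → UnitAddCircle),
        (cone (chartInter S)).indicator (f ⟨S.erase i.1, hcard i.1 i.2⟩).1 (torusPt x) =
          (f ⟨S.erase i.1, hcard i.1 i.2⟩).1 (torusPt x) := fun i x => by
      rw [cone_chartInter hS, Set.indicator_of_mem (torusPt_mem_nonvanishing S x)]
    rw [hval, laurentCoeff_sum]
    · refine Finset.sum_congr rfl fun i _ => ?_
      rw [laurentCoeff_smul, laurentCoeff_congr (hind i), cochainCoeff_of_card (hcard i.1 i.2)]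
    · intro i _
      have h1 : ContinuousOnTorus (f ⟨S.erase i.1, hcard i.1 i.2⟩).1 :=
        .of_differentiableOn (holSections_differentiableOn
          (nonempty_of_card_eq_succ (hcard i.1 i.2)) _)
      unfold ContinuousOnTorus at h1 ⊢
      simp only [Pi.smul_apply, hind i]
      exact continuous_const.mul h1
  · rw [cochainCoeff_of_card_ne h]
    refine (Finset.sum_eq_zero fun i hi => ?_).symm
    rw [cochainCoeff_of_card_ne, mul_zero]
    rw [Finset.card_erase_of_mem hi]
    have := Finset.card_pos.2 ⟨i, hi⟩
    omega

theorem cechD_mem_cocycles (g : Cochains k m p) : cechD k m p g ∈ cocycles k m (p + 1) := by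
  refine cochain_ext fun S a => ?_
  rw [map_zero, cochainCoeff_cechD]
  simp only [cochainCoeff_cechD, Finset.mul_sum]
  rw [Finset.sum_sigma']
  -- the two ways of omitting a pair of indices cancel
  refine Finset.sum_involution (fun x _ => ⟨x.2, x.1⟩) ?_ ?_ ?_ ?_
  · rintro ⟨i, j⟩ hx
    simp only [Finset.mem_sigma, Finset.mem_erase] at hx
    obtain ⟨hi, hji, hj⟩ := hx
    rw [Finset.erase_right_comm (a := j) (b := i)]
    linear_combination cochainCoeff ((S.erase i).erase j) a g *
      faceSign_mul_faceSign_erase hi hj hji.symm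
  · rintro ⟨i, j⟩ hx _ h
    simp only [Finset.mem_sigma, Finset.mem_erase] at hx
    exact hx.2.1 (congrArg Sigma.fst h)
  · rintro ⟨i, j⟩ hx
    simp only [Finset.mem_sigma, Finset.mem_erase] at hx ⊢
    exact ⟨hx.2.2, hx.2.1.symm, hx.1⟩
  · rintro ⟨i, j⟩ _
    rfl

/-- The contracting homotopy for the variable `w_i`, in terms of Laurent coefficients: extend the
component at `S ∪ {i}`, after removal of its negative powers of `w_i`, to `S`. -/
theorem exists_homotopy (i : Fin (k + 1)) (f : Cochains k m (p + 1)) :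
    ∃ g : Cochains k m p, ∀ S a, cochainCoeff S a g =
      if i ∉ S ∧ 0 ≤ a i then faceSign i S * cochainCoeff (insert i S) a f else 0 := by
  have key : ∀ S : {S : Finset (Fin (k + 1)) // S.card = p + 1},
      ∃ s : holSections k m (chartInter S.1), ∀ a, laurentCoeff s.1 a =
        if i ∉ S.1 ∧ 0 ≤ a i then faceSign i S.1 * cochainCoeff (insert i S.1) a f else 0 := by
    rintro ⟨S, hS⟩
    by_cases hi : i ∈ S
    · exact ⟨0, fun a => by simpa [hi] using laurentCoeff_zero a⟩
    · have hcard : (insert i S).card = p + 1 + 1 := by rw [Finset.card_insert_of_notMem hi, hS]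
      have hne := nonempty_of_card_eq_succ hS
      obtain ⟨g, hg, hga⟩ := exists_nonnegative_part (i := i) (holSections_differentiableOn
        (nonempty_of_card_eq_succ hcard) (f ⟨insert i S, hcard⟩))
      rw [Finset.erase_insert hi] at hg
      simp only [← cochainCoeff_of_card hcard] at hga
      refine ⟨faceSign i S • sectionOfCoeff m hne g hg fun a ha => ?_, fun a => ?_⟩
      · rw [hga, cochainCoeff_eq_zero_of_sum_ne f _ ha, ite_self]
      · refine (laurentCoeff_smul _ _ a).trans ?_
        rw [laurentCoeff_sectionOfCoeff, hga]
        simp [hi]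
  obtain ⟨g, hg⟩ : ∃ g : Cochains k m p, ∀ S a, laurentCoeff (g S).1 a =
      if i ∉ S.1 ∧ 0 ≤ a i then faceSign i S.1 * cochainCoeff (insert i S.1) a f else 0 :=
    ⟨fun S => (key S).choose, fun S => (key S).choose_spec⟩
  refine ⟨g, fun S a => ?_⟩
  by_cases h : S.card = p + 1
  · rw [cochainCoeff_of_card h, hg]
  · rw [cochainCoeff_of_card_ne h]
    split_ifs with hi
    · rw [cochainCoeff_of_card_ne, mul_zero]
      rw [Finset.card_insert_of_notMem hi.1]
      omega
    · rfl

/-- The homotopy for `w_i` moves a cocycle to a cohomologous one which is supported on the sets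
containing `i` and has only negative powers of `w_i`. -/
theorem exists_cohomologous_of_mem_cocycles (i : Fin (k + 1)) {f : Cochains k m (p + 1)}
    (hf : f ∈ cocycles k m (p + 1)) :
    ∃ g : Cochains k m p, ∀ S a, cochainCoeff S a (f - cechD k m p g) =
      if i ∈ S ∧ a i < 0 then cochainCoeff S a f else 0 := by
  obtain ⟨g, hg⟩ := exists_homotopy i f
  refine ⟨g, fun S a => ?_⟩
  rw [map_sub, cochainCoeff_cechD]
  simp only [hg]
  rcases lt_or_ge (a i) 0 with ha | ha
  · -- the homotopy does not see negative powers of `w_i`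
    simp only [ha.not_ge, and_false, if_false, mul_zero, Finset.sum_const_zero, sub_zero]
    by_cases hi : i ∈ S
    · simp [hi, ha]
    · simp [hi, cochainCoeff_eq_zero_of_neg f hi ha]
  · simp only [ha, ha.not_gt, and_true, and_false, if_false]
    by_cases hi : i ∈ S
    · -- only the face omitting `i` contributes, and it returns the component itself
      rw [Finset.sum_eq_single i]
      · simp only [Finset.notMem_erase, not_false_eq_true, if_true, Finset.insert_erase hi,
          faceSign_erase_self i hi]
        rw [← mul_assoc, faceSign_mul_self, one_mul, sub_self]
      · intro j _ hji
        simp [hi, hji.symm]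
      · exact fun h => (h hi).elim
    · -- here the claim is the cocycle condition on the set obtained by adding `i`
      have h0 : cochainCoeff (insert i S) a (cechD k m (p + 1) f) = 0 := by
        rw [show cechD k m (p + 1) f = 0 from hf, map_zero]
      rw [cochainCoeff_cechD, Finset.sum_insert hi, faceSign_insert_self i hi,
        Finset.erase_insert hi] at h0
      have h1 : ∑ j ∈ S, faceSign j S * (if i ∉ S.erase j then
          faceSign i (S.erase j) * cochainCoeff (insert i (S.erase j)) a f else 0) =
          -(faceSign i S * ∑ j ∈ S, faceSign j (insert i S) *
            cochainCoeff ((insert i S).erase j) a f) := by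
        rw [Finset.mul_sum, ← Finset.sum_neg_distrib]
        refine Finset.sum_congr rfl fun j hj => ?_
        have hij : i ≠ j := by rintro rfl; exact hi hj
        rw [if_pos (fun h => hi (Finset.mem_of_mem_erase h)), Finset.erase_insert_of_ne hij]
        linear_combination (cochainCoeff (insert i (S.erase j)) a f) *
          faceSign_mul_faceSign_insert hi hj
      rw [h1]
      linear_combination faceSign i S * h0 - cochainCoeff S a f * faceSign_mul_self i S

/-- Every cocycle of positive degree is cohomologous to one which lives on the intersection of all
charts and has only monomials with negative exponents. -/
theorem exists_cohomologous_negative {f : Cochains k m (p + 1)} (hf : f ∈ cocycles k m (p + 1)) :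
    ∃ g : Cochains k m p, ∀ S a, cochainCoeff S a (f - cechD k m p g) =
      if S = Finset.univ ∧ ∀ i, a i < 0 then cochainCoeff S a f else 0 := by
  have key : ∀ J : Finset (Fin (k + 1)), ∃ g : Cochains k m p,
      f - cechD k m p g ∈ cocycles k m (p + 1) ∧
      ∀ S a, cochainCoeff S a (f - cechD k m p g) =
        if ∀ i ∈ J, i ∈ S ∧ a i < 0 then cochainCoeff S a f else 0 := by
    intro J
    induction J using Finset.induction_on with
    | empty => exact ⟨0, by simpa using hf, by simp⟩
    | insert i J hi ih =>
      obtain ⟨g, hg, hgc⟩ := ih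
      obtain ⟨g', hg'⟩ := exists_cohomologous_of_mem_cocycles i hg
      have hsub : f - cechD k m p (g + g') = f - cechD k m p g - cechD k m p g' := by
        rw [map_add, sub_add_eq_sub_sub]
      have hdd : cechD k m p g' ∈ cocycles k m (p + 1) := cechD_mem_cocycles g'
      refine ⟨g + g', ?_, fun S a => ?_⟩
      · rw [hsub]
        exact Submodule.sub_mem _ hg hdd
      · rw [hsub, hg', hgc]
        simp only [Finset.forall_mem_insert, ite_and]
  obtain ⟨g, _, hg⟩ := key Finset.univ
  refine ⟨g, fun S a => ?_⟩
  rw [hg]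
  have : (∀ i ∈ Finset.univ, i ∈ S ∧ a i < 0) ↔ S = Finset.univ ∧ ∀ i, a i < 0 := by
    simp [Finset.eq_univ_iff_forall, forall_and]
  simp only [this]

/-- A cocycle of positive degree is a coboundary as soon as its Laurent coefficients with negative
exponents on the intersection of all charts vanish. -/
theorem mem_coboundaries_of_cochainCoeff_eq_zero {f : Cochains k m (p + 1)}
    (hf : f ∈ cocycles k m (p + 1))
    (h : ∀ a : Fin (k + 1) → ℤ, (∀ i, a i < 0) → cochainCoeff Finset.univ a f = 0) :
    f ∈ coboundaries k m (p + 1) := by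
  obtain ⟨g, hg⟩ := exists_cohomologous_negative hf
  refine ⟨g, (sub_eq_zero.1 (cochain_ext fun S a => ?_)).symm⟩
  rw [hg, map_zero]
  split_ifs with hS
  · rw [hS.1, h a hS.2]
  · rfl

theorem cochainCoeff_univ_cechD (g : Cochains k m p) {a : Fin (k + 1) → ℤ} (ha : ∀ i, a i < 0) :
    cochainCoeff Finset.univ a (cechD k m p g) = 0 := by
  rw [cochainCoeff_cechD]
  refine Finset.sum_eq_zero fun i _ => ?_
  rw [cochainCoeff_eq_zero_of_neg g (Finset.notMem_erase i _) (ha i), mul_zero]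

theorem cochainCoeff_pullCochain (q : Circle) (f : Cochains k m p) (S : Finset (Fin (k + 1)))
    (a : Fin (k + 1) → ℤ) : cochainCoeff S a (pullCochain k m p q f) =
      (q : ℂ) ^ (∑ j : Fin (k + 1), (j : ℤ) * a j) * cochainCoeff S a f := by
  by_cases h : S.card = p + 1
  · rw [cochainCoeff_of_card h, cochainCoeff_of_card h]
    have h1 := laurentCoeff_mul_left (u := fun j : Fin (k + 1) => (q : ℂ) ^ (j : ℕ))
      (fun j => by rw [norm_pow, Circle.norm_coe, one_pow]) (f ⟨S, h⟩).1 a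
    have h2 : laurentMonomial a (fun j : Fin (k + 1) => (q : ℂ) ^ (j : ℕ)) =
        (q : ℂ) ^ (∑ j : Fin (k + 1), (j : ℤ) * a j) := by
      rw [laurentMonomial]
      induction (Finset.univ : Finset (Fin (k + 1))) using Finset.cons_induction with
      | empty => simp
      | cons i s hi ih =>
        rw [Finset.prod_cons, Finset.sum_cons, zpow_add₀ (Circle.coe_ne_zero q), ih, zpow_mul,
          zpow_natCast]
    rw [h2] at h1
    exact h1
  · rw [cochainCoeff_of_card_ne h, cochainCoeff_of_card_ne h, mul_zero]

end

/-! ### The characters of the cohomology groups -/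

section

/-- The weight `∑_j j a_j` of the Laurent monomial `∏_j w_j ^ a_j` under the action of `U(1)`. -/
def exponentWeight {k : ℕ} (a : Fin (k + 1) → ℤ) : ℤ := ∑ j : Fin (k + 1), (j : ℤ) * a j

/-- The exponents of the monomials of degree `m`. -/
def posExponents (k : ℕ) (m : ℤ) : Finset (Fin (k + 1) → ℤ) :=
  (Finset.Icc 0 (fun _ => m)).filter fun a => ∑ i, a i = m

/-- The exponents of the Laurent monomials of degree `m` all of whose exponents are negative. -/
def negExponents (k : ℕ) (m : ℤ) : Finset (Fin (k + 1) → ℤ) :=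
  (Finset.Icc (fun _ => m) (-1)).filter fun a => ∑ i, a i = m

theorem mem_posExponents {k : ℕ} {m : ℤ} {a : Fin (k + 1) → ℤ} :
    a ∈ posExponents k m ↔ (∀ i, 0 ≤ a i) ∧ ∑ i, a i = m := by
  simp only [posExponents, Finset.mem_filter, Finset.mem_Icc, Pi.le_def]
  refine ⟨fun h => ⟨h.1.1, h.2⟩, fun h => ⟨⟨h.1, fun i => ?_⟩, h.2⟩⟩
  rw [← h.2]
  exact Finset.single_le_sum (fun j _ => h.1 j) (Finset.mem_univ i)

theorem mem_negExponents {k : ℕ} {m : ℤ} {a : Fin (k + 1) → ℤ} :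
    a ∈ negExponents k m ↔ (∀ i, a i < 0) ∧ ∑ i, a i = m := by
  simp only [negExponents, Finset.mem_filter, Finset.mem_Icc, Pi.le_def, Pi.neg_apply,
    Pi.one_apply]
  refine ⟨fun h => ⟨fun i => by have := h.1.2 i; omega, h.2⟩,
    fun h => ⟨⟨fun i => ?_, fun i => by have := h.1 i; omega⟩, h.2⟩⟩
  have h1 : ∑ j, -a j = -m := by rw [Finset.sum_neg_distrib, h.2]
  have h2 := Finset.single_le_sum (f := fun j => -a j) (fun j _ => by have := h.1 j; simp; omega)
    (Finset.mem_univ i)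
  simp only [h1] at h2
  omega

theorem disjoint_posExponents_negExponents (k : ℕ) (m : ℤ) :
    Disjoint (posExponents k m) (negExponents k m) := by
  rw [Finset.disjoint_left]
  intro a h1 h2
  exact absurd ((mem_posExponents.1 h1).1 0) (not_le.2 ((mem_negExponents.1 h2).1 0))

/-- The exponents of the monomials that form a basis of `H^p(ℂP^k, 𝒪(m))`. -/
def cohomologyExponents (k : ℕ) (m : ℤ) (p : ℕ) : Finset (Fin (k + 1) → ℤ) :=
  (if p = 0 then posExponents k m else ∅) ∪ (if p = k then negExponents k m else ∅)

theorem mem_cohomologyExponents {k : ℕ} {m : ℤ} {p : ℕ} {a : Fin (k + 1) → ℤ} :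
    a ∈ cohomologyExponents k m p ↔
      (p = 0 ∧ a ∈ posExponents k m) ∨ (p = k ∧ a ∈ negExponents k m) := by
  rw [cohomologyExponents, Finset.mem_union]
  refine or_congr ?_ ?_
  · by_cases h : p = 0 <;> simp [h]
  · by_cases h : p = k <;> simp [h]

/-- The trace of a diagonal operator. -/
theorem trace_of_apply_eq_mul {W : Type*} [Fintype W] [DecidableEq W] (c : W → ℂ)
    (D : (W → ℂ) →ₗ[ℂ] (W → ℂ)) (hD : ∀ v a, D v a = c a * v a) :
    LinearMap.trace ℂ _ D = ∑ a, c a := by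
  have : D = Matrix.toLin' (Matrix.diagonal c) := by
    refine LinearMap.ext fun v => funext fun a => ?_
    rw [hD, Matrix.toLin'_apply, Matrix.mulVec_diagonal]
  rw [this, Matrix.trace_toLin'_eq, Matrix.trace_diagonal]

variable {k : ℕ} {m : ℤ} {p : ℕ}

/-- If finitely many Laurent coefficients of the component at `S` separate cohomology classes and
take arbitrary values, then they identify the cohomology with a representation on which `U(1)` acts
diagonally. -/
theorem finite_and_trace_of_cochainCoeff (S : Finset (Fin (k + 1)))
    (W : Finset (Fin (k + 1) → ℤ))
    (hinj : ∀ f ∈ cocycles k m p, (∀ a ∈ W, cochainCoeff S a f = 0) → f ∈ coboundaries k m p)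
    (hzero : ∀ f ∈ coboundaries k m p, ∀ a ∈ W, cochainCoeff S a f = 0)
    (hsurj : ∀ a ∈ W, ∃ f ∈ cocycles k m p, ∀ b, cochainCoeff S b f = if b = a then 1 else 0) :
    Module.Finite ℂ (Cohomology k m p) ∧
      ∀ q : Circle, LinearMap.trace ℂ _ (cohomologyRep k m p q) =
        ∑ a ∈ W, (q : ℂ) ^ exponentWeight a := by
  let Φ : cocycles k m p →ₗ[ℂ] (W → ℂ) :=
    LinearMap.pi fun a => (cochainCoeff S a.1) ∘ₗ (cocycles k m p).subtype
  have hΦ : ∀ f a, Φ f a = cochainCoeff S a.1 f.1 := fun _ _ => rfl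
  have hker : LinearMap.ker Φ = (coboundaries k m p).submoduleOf (cocycles k m p) := by
    ext f
    rw [LinearMap.mem_ker, Submodule.submoduleOf, Submodule.mem_comap]
    exact ⟨fun h => hinj f.1 f.2 fun a ha => congrFun h ⟨a, ha⟩,
      fun h => funext fun a => hzero f.1 h a.1 a.2⟩
  have hrange : Function.Surjective Φ := by
    intro v
    choose F hF hFc using hsurj
    refine ⟨∑ a : W, v a • ⟨F a.1 a.2, hF a.1 a.2⟩, funext fun b => ?_⟩
    rw [map_sum, Finset.sum_apply, Finset.sum_eq_single b]
    · simp [hΦ, hFc]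
    · intro a _ hab
      have : b.1 ≠ a.1 := fun h => hab (Subtype.ext h.symm)
      simp [hΦ, hFc, this]
    · simp
  let e : Cohomology k m p ≃ₗ[ℂ] (W → ℂ) :=
    (Submodule.quotEquivOfEq _ _ hker.symm).trans (Φ.quotKerEquivOfSurjective hrange)
  have he : ∀ f, e (Submodule.Quotient.mk f) = Φ f := fun _ => rfl
  refine ⟨Module.Finite.equiv e.symm, fun q => ?_⟩
  rw [← LinearMap.trace_conj' (cohomologyRep k m p q) e,
    trace_of_apply_eq_mul (fun a : W => (q : ℂ) ^ exponentWeight a.1)]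
  · exact Finset.sum_coe_sort W fun a => (q : ℂ) ^ exponentWeight a
  · intro v a
    obtain ⟨x, rfl⟩ := e.surjective v
    obtain ⟨f, rfl⟩ := Submodule.Quotient.mk_surjective _ x
    rw [LinearEquiv.conj_apply_apply, LinearEquiv.symm_apply_apply]
    exact cochainCoeff_pullCochain q f.1 S a.1

theorem differentiableOn_laurentMonomial {S : Finset (Fin (k + 1))} {a : Fin (k + 1) → ℤ}
    (ha : ∀ i ∉ S, 0 ≤ a i) : DifferentiableOn ℂ (laurentMonomial a) (nonvanishing S) := by
  intro w hw
  have h : ∀ i, DifferentiableWithinAt ℂ (fun w : Fin (k + 1) → ℂ => w i ^ a i)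
      (nonvanishing S) w := by
    intro i
    have h1 : DifferentiableAt ℂ (fun z : ℂ => z ^ a i) (w i) := by
      rw [differentiableAt_zpow]
      by_cases hi : i ∈ S
      · exact Or.inl (hw i hi)
      · exact Or.inr (ha i hi)
    exact (h1.comp w (by fun_prop : DifferentiableAt ℂ (fun w : Fin (k + 1) → ℂ => w i)
      w)).differentiableWithinAt
  unfold laurentMonomial
  induction (Finset.univ : Finset (Fin (k + 1))) using Finset.cons_induction with
  | empty => simpa using differentiableWithinAt_const 1
  | cons i s hi ih =>
    simp only [Finset.prod_cons]
    exact (h i).mul ih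

/-- The cochain all of whose components are a given Laurent monomial. -/
theorem exists_cochain_laurentMonomial {a : Fin (k + 1) → ℤ}
    (ha : ∀ S : Finset (Fin (k + 1)), S.card = p + 1 → ∀ i ∉ S, 0 ≤ a i) (hm : ∑ i, a i = m) :
    ∃ f : Cochains k m p, ∀ S b,
      cochainCoeff S b f = if S.card = p + 1 ∧ b = a then 1 else 0 := by
  obtain ⟨f, hf⟩ : ∃ f : Cochains k m p, ∀ S b,
      laurentCoeff (f S).1 b = if b = a then 1 else 0 := by
    refine ⟨fun S => sectionOfCoeff m (nonempty_of_card_eq_succ S.2) (laurentMonomial a)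
      (differentiableOn_laurentMonomial (ha S.1 S.2)) fun b hb => ?_, fun S b => ?_⟩
    · refine laurentCoeff_laurentMonomial_of_ne ?_
      rintro rfl
      exact hb hm
    · rw [laurentCoeff_sectionOfCoeff, laurentCoeff_laurentMonomial]
  refine ⟨f, fun S b => ?_⟩
  by_cases hS : S.card = p + 1
  · simp [cochainCoeff_of_card hS, hf, hS]
  · simp [cochainCoeff_of_card_ne hS, hS]

/-- The components of a cocycle of degree zero have the same Laurent coefficients, so for `k ≥ 1` no
exponent can be negative. -/
theorem cohomology_zero (k : ℕ) (m : ℤ) : Module.Finite ℂ (Cohomology k m 0) ∧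
    ∀ q : Circle, LinearMap.trace ℂ _ (cohomologyRep k m 0 q) =
      ∑ a ∈ cohomologyExponents k m 0, (q : ℂ) ^ exponentWeight a := by
  -- for `k = 0` the only chart is the whole space, and negative exponents are allowed
  have hdom : ∀ a ∈ cohomologyExponents k m 0,
      (∀ S : Finset (Fin (k + 1)), S.card = 0 + 1 → ∀ i ∉ S, 0 ≤ a i) ∧ ∑ i, a i = m := by
    intro a ha
    rcases mem_cohomologyExponents.1 ha with ⟨-, h⟩ | ⟨h0, h⟩
    · exact ⟨fun _ _ i _ => (mem_posExponents.1 h).1 i, (mem_posExponents.1 h).2⟩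
    · subst h0
      refine ⟨fun S hS i hi => (hi ?_).elim, (mem_negExponents.1 h).2⟩
      obtain ⟨j, rfl⟩ := Finset.card_eq_one.1 hS
      rw [Finset.mem_singleton]
      exact (Subsingleton.elim (α := Fin 1) i j)
  refine finite_and_trace_of_cochainCoeff {0} _ (fun f hf h => ?_) (fun f hf a _ => ?_)
    fun a ha => ?_
  · have heq : ∀ (i : Fin (k + 1)) b, cochainCoeff {i} b f = cochainCoeff {0} b f := by
      intro i b
      rcases eq_or_ne i 0 with rfl | hi
      · rfl
      · have h0 : cochainCoeff {0, i} b (cechD k m 0 f) = 0 := by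
          rw [show cechD k m 0 f = 0 from hf, map_zero]
        have hlt : 0 < i := Fin.pos_iff_ne_zero.2 hi
        have e1 : ({0, i} : Finset (Fin (k + 1))).erase 0 = {i} := by
          rw [Finset.erase_insert (by simpa using hi.symm)]
        have e2 : ({0, i} : Finset (Fin (k + 1))).erase i = {0} := by
          rw [Finset.pair_comm, Finset.erase_insert (by simpa using hi)]
        rw [cochainCoeff_cechD, Finset.sum_pair hi.symm, e1, e2] at h0
        have s1 : faceSign 0 ({0, i} : Finset (Fin (k + 1))) = 1 := by
          simp [faceSign, Finset.filter_insert]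
        have s2 : faceSign i ({0, i} : Finset (Fin (k + 1))) = -1 := by
          simp [faceSign, Finset.filter_insert, hlt, Finset.filter_singleton]
        rw [s1, s2] at h0
        linear_combination h0
    have hall : ∀ b, cochainCoeff {0} b f = 0 := by
      intro b
      by_cases hm : ∑ i, b i = m
      · by_cases hb : b ∈ cohomologyExponents k m 0
        · exact h b hb
        · -- some exponent is negative, and there is another chart
          have hpos : ¬ ∀ i, 0 ≤ b i := fun hp =>
            hb (mem_cohomologyExponents.2 (Or.inl ⟨rfl, mem_posExponents.2 ⟨hp, hm⟩⟩))
          obtain ⟨j, hj⟩ := not_forall.1 hpos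
          obtain ⟨i, hij⟩ : ∃ i : Fin (k + 1), j ≠ i := by
            by_contra hno
            push Not at hno
            have hk : k = 0 := by
              have h1 := hno 0
              have h2 := hno (Fin.last k)
              rw [h1] at h2
              simpa using (congrArg Fin.val h2).symm
            refine hb (mem_cohomologyExponents.2 (Or.inr ⟨hk.symm, mem_negExponents.2
              ⟨fun i => ?_, hm⟩⟩))
            rw [← hno i]
            exact not_le.1 hj
          rw [← heq i b]
          exact cochainCoeff_eq_zero_of_neg f (by simpa using hij) (not_le.1 hj)
      · exact cochainCoeff_eq_zero_of_sum_ne f _ hm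
    have : f = 0 := by
      refine cochain_ext fun S b => ?_
      rw [map_zero]
      by_cases hS : S.card = 0 + 1
      · obtain ⟨i, rfl⟩ := Finset.card_eq_one.1 hS
        rw [heq, hall]
      · exact cochainCoeff_of_card_ne hS b f
    rw [this]
    exact Submodule.zero_mem _
  · have : f = 0 := hf
    rw [this, map_zero]
  · obtain ⟨f, hf⟩ := exists_cochain_laurentMonomial (hdom a ha).1 (hdom a ha).2
    refine ⟨f, ?_, fun b => by simp [hf]⟩
    refine cochain_ext fun S b => ?_
    rw [map_zero]
    by_cases hS : S.card = 0 + 1 + 1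
    · obtain ⟨i, j, hij, rfl⟩ := Finset.card_eq_two.1 hS
      have hsign := faceSign_mul_faceSign_erase (i := i) (j := j) (S := {i, j}) (by simp)
        (by simp) hij
      have e1 : ({i, j} : Finset (Fin (k + 1))).erase i = {j} := by
        rw [Finset.erase_insert (by simpa using hij)]
      have e2 : ({i, j} : Finset (Fin (k + 1))).erase j = {i} := by
        rw [Finset.pair_comm, Finset.erase_insert (by simpa using hij.symm)]
      rw [cochainCoeff_cechD, Finset.sum_pair hij, hf, hf, e1, e2]
      have s : ∀ l : Fin (k + 1), faceSign l {l} = 1 := fun l => by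
        simp [faceSign, Finset.filter_singleton]
      rw [e1, e2, s, s] at hsign
      simp only [Finset.card_singleton, zero_add, true_and, mul_one] at hsign ⊢
      rw [hsign]
      ring
    · exact cochainCoeff_of_card_ne hS b _

theorem cohomology_succ (k : ℕ) (m : ℤ) (p : ℕ) : Module.Finite ℂ (Cohomology k m (p + 1)) ∧
    ∀ q : Circle, LinearMap.trace ℂ _ (cohomologyRep k m (p + 1) q) =
      ∑ a ∈ cohomologyExponents k m (p + 1), (q : ℂ) ^ exponentWeight a := by
  have hmem : ∀ a, a ∈ cohomologyExponents k m (p + 1) ↔ p + 1 = k ∧ a ∈ negExponents k m := by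
    simp [mem_cohomologyExponents]
  refine finite_and_trace_of_cochainCoeff Finset.univ _ (fun f hf h => ?_) (fun f hf a ha => ?_)
    fun a ha => ?_
  · refine mem_coboundaries_of_cochainCoeff_eq_zero hf fun a ha => ?_
    by_cases hk : p + 1 = k
    · by_cases hm : ∑ i, a i = m
      · exact h a ((hmem a).2 ⟨hk, mem_negExponents.2 ⟨ha, hm⟩⟩)
      · exact cochainCoeff_eq_zero_of_sum_ne f _ hm
    · refine cochainCoeff_of_card_ne ?_ a f
      rw [Finset.card_univ, Fintype.card_fin]
      omega
  · obtain ⟨g, rfl⟩ := hf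
    exact cochainCoeff_univ_cechD g (mem_negExponents.1 ((hmem a).1 ha).2).1
  · obtain ⟨hk, ha⟩ := (hmem a).1 ha
    subst hk
    obtain ⟨f, hf⟩ := exists_cochain_laurentMonomial (p := p + 1) (a := a) (m := m)
      (fun S hS i hi => (hi (by
        rw [(Finset.card_eq_iff_eq_univ S).1 (by rw [hS, Fintype.card_fin])]
        exact Finset.mem_univ i)).elim) (mem_negExponents.1 ha).2
    refine ⟨f, cochain_ext fun S b => ?_, fun b => by simp [hf]⟩
    rw [map_zero]
    refine cochainCoeff_of_card_ne ?_ b _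
    have := Finset.card_le_univ S
    rw [Fintype.card_fin] at this
    omega

theorem finite_cohomology (k : ℕ) (m : ℤ) (p : ℕ) : Module.Finite ℂ (Cohomology k m p) := by
  cases p with
  | zero => exact (cohomology_zero k m).1
  | succ p => exact (cohomology_succ k m p).1

theorem trace_cohomologyRep (k : ℕ) (m : ℤ) (p : ℕ) (q : Circle) :
    LinearMap.trace ℂ _ (cohomologyRep k m p q) =
      ∑ a ∈ cohomologyExponents k m p, (q : ℂ) ^ exponentWeight a := by
  cases p with
  | zero => exact (cohomology_zero k m).2 q
  | succ p => exact (cohomology_succ k m p).2 q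

/-- The alternating sum of the characters of the two kinds of monomials. -/
def monomialCharacter (k : ℕ) (m : ℤ) (q : ℂ) : ℂ :=
  ∑ a ∈ posExponents k m, q ^ exponentWeight a +
    (-1) ^ k * ∑ a ∈ negExponents k m, q ^ exponentWeight a

theorem equivariantEuler_eq (k : ℕ) (m : ℤ) (q : Circle) :
    equivariantEuler k m q = monomialCharacter k m q := by
  have h : ∀ p, ∑ a ∈ cohomologyExponents k m p, (q : ℂ) ^ exponentWeight a =
      (if p = 0 then ∑ a ∈ posExponents k m, (q : ℂ) ^ exponentWeight a else 0) +
        (if p = k then ∑ a ∈ negExponents k m, (q : ℂ) ^ exponentWeight a else 0) := by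
    intro p
    rw [cohomologyExponents, Finset.sum_union]
    · split_ifs <;> simp
    · split_ifs
      · exact disjoint_posExponents_negExponents k m
      all_goals simp
  simp only [equivariantEuler, trace_cohomologyRep, h, mul_add, Finset.sum_add_distrib, mul_ite,
    mul_zero, Finset.sum_ite_eq', Finset.mem_range, Nat.lt_succ_self, Nat.succ_pos, if_true]
  simp [monomialCharacter]

/-- At `q = 1` the traces are dimensions. -/
theorem equivariantEuler_one (k : ℕ) (m : ℤ) : equivariantEuler k m 1 = (eulerChar k m : ℂ) := by
  rw [equivariantEuler, eulerChar]
  push_cast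
  refine Finset.sum_congr rfl fun p _ => ?_
  have := finite_cohomology k m p
  rw [map_one, LinearMap.trace_one]

end

/-! ### The Pascal rule and Gaussian binomial coefficients -/

theorem exponentWeight_snoc {k : ℕ} (b : Fin (k + 1) → ℤ) (c : ℤ) :
    exponentWeight (Fin.snoc (α := fun _ => ℤ) b c : Fin (k + 2) → ℤ) =
      exponentWeight b + (k + 1) * c := by
  rw [exponentWeight, Fin.sum_univ_castSucc]
  simp [exponentWeight]

theorem sum_snoc {k : ℕ} (b : Fin (k + 1) → ℤ) (c : ℤ) :
    ∑ i, (Fin.snoc (α := fun _ => ℤ) b c : Fin (k + 2) → ℤ) i = ∑ i, b i + c := by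
  rw [Fin.sum_univ_castSucc]
  simp

theorem forall_snoc {k : ℕ} (P : ℤ → Prop) (b : Fin (k + 1) → ℤ) (c : ℤ) :
    (∀ i, P ((Fin.snoc (α := fun _ => ℤ) b c : Fin (k + 2) → ℤ) i)) ↔ (∀ i, P (b i)) ∧ P c := by
  rw [Fin.forall_fin_succ']
  simp

theorem snoc_mem_posExponents {k : ℕ} {m : ℤ} {b : Fin (k + 1) → ℤ} {c : ℤ} :
    (Fin.snoc (α := fun _ => ℤ) b c : Fin (k + 2) → ℤ) ∈ posExponents (k + 1) m ↔
      (∀ i, 0 ≤ b i) ∧ 0 ≤ c ∧ ∑ i, b i + c = m := by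
  rw [mem_posExponents, sum_snoc, forall_snoc (fun x => 0 ≤ x), and_assoc]

theorem snoc_mem_negExponents {k : ℕ} {m : ℤ} {b : Fin (k + 1) → ℤ} {c : ℤ} :
    (Fin.snoc (α := fun _ => ℤ) b c : Fin (k + 2) → ℤ) ∈ negExponents (k + 1) m ↔
      (∀ i, b i < 0) ∧ c < 0 ∧ ∑ i, b i + c = m := by
  rw [mem_negExponents, sum_snoc, forall_snoc (fun x => x < 0), and_assoc]

/-- Sums over a set `C` of exponents in `k + 2` variables, split according to the last exponent: if it
equals `c`, it is omitted, which gives the set `A`; otherwise it is lowered by `e`, which gives the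
set `B`. -/
theorem sum_eq_sum_add_sum_of_snoc {k : ℕ} {q : ℂ} (hq : q ≠ 0)
    {A : Finset (Fin (k + 1) → ℤ)} {B C : Finset (Fin (k + 2) → ℤ)} (c e : ℤ)
    (hA : ∀ b, b ∈ A ↔ (Fin.snoc (α := fun _ => ℤ) b c : Fin (k + 2) → ℤ) ∈ C)
    (hB : ∀ b x, (Fin.snoc (α := fun _ => ℤ) b x : Fin (k + 2) → ℤ) ∈ B ↔
      x + e ≠ c ∧ (Fin.snoc (α := fun _ => ℤ) b (x + e) : Fin (k + 2) → ℤ) ∈ C) :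
    ∑ a ∈ C, q ^ exponentWeight a =
      q ^ ((k + 1) * c) * ∑ a ∈ A, q ^ exponentWeight a +
        q ^ ((k + 1) * e) * ∑ a ∈ B, q ^ exponentWeight a := by
  have hsnoc : ∀ a : Fin (k + 2) → ℤ,
      (Fin.snoc (α := fun _ => ℤ) (Fin.init a) (a (Fin.last _)) : Fin (k + 2) → ℤ) = a :=
    fun a => Fin.snoc_init_self a
  rw [← Finset.sum_filter_add_sum_filter_not C fun a => a (Fin.last _) = c]
  congr 1
  · rw [Finset.mul_sum]
    refine Finset.sum_nbij' (fun a => Fin.init a)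
      (fun b => (Fin.snoc (α := fun _ => ℤ) b c : Fin (k + 2) → ℤ)) ?_ ?_ ?_ ?_ ?_
    · intro a ha
      obtain ⟨h1, h2⟩ := Finset.mem_filter.1 ha
      rw [hA, ← h2, hsnoc]
      exact h1
    · intro b hb
      exact Finset.mem_filter.2 ⟨(hA b).1 hb, by simp⟩
    · intro a ha
      rw [← (Finset.mem_filter.1 ha).2, hsnoc]
    · intro b _
      simp
    · intro a ha
      conv_lhs => rw [← hsnoc a, (Finset.mem_filter.1 ha).2, exponentWeight_snoc, zpow_add₀ hq,
        mul_comm]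
  · rw [Finset.mul_sum]
    refine Finset.sum_nbij'
      (fun a => (Fin.snoc (α := fun _ => ℤ) (Fin.init a) (a (Fin.last _) - e) : Fin (k + 2) → ℤ))
      (fun a => (Fin.snoc (α := fun _ => ℤ) (Fin.init a) (a (Fin.last _) + e) : Fin (k + 2) → ℤ))
      ?_ ?_ ?_ ?_ ?_
    · intro a ha
      obtain ⟨h1, h2⟩ := Finset.mem_filter.1 ha
      rw [hB, sub_add_cancel, hsnoc]
      exact ⟨h2, h1⟩
    · intro a ha
      rw [← hsnoc a, hB] at ha
      exact Finset.mem_filter.2 ⟨ha.2, by simpa using ha.1⟩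
    · intro a _
      simp [hsnoc]
    · intro a _
      simp [hsnoc]
    · intro a _
      conv_lhs => rw [← hsnoc a]
      rw [exponentWeight_snoc, exponentWeight_snoc, ← zpow_add₀ hq]
      congr 1
      ring

/-- The Pascal rule for the character, which comes from splitting monomials according to the
exponent of the last variable. -/
theorem monomialCharacter_succ (k : ℕ) (m : ℤ) {q : ℂ} (hq : q ≠ 0) :
    monomialCharacter (k + 1) m q =
      monomialCharacter k m q + q ^ (k + 1) * monomialCharacter (k + 1) (m - 1) q := by
  have hpos := sum_eq_sum_add_sum_of_snoc (k := k) hq (A := posExponents k m)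
    (B := posExponents (k + 1) (m - 1)) (C := posExponents (k + 1) m) 0 1
    (fun b => by rw [snoc_mem_posExponents, mem_posExponents]; simp)
    (fun b x => by
      rw [snoc_mem_posExponents, snoc_mem_posExponents]
      constructor
      · rintro ⟨h1, h2, h3⟩
        exact ⟨by omega, h1, by omega, by omega⟩
      · rintro ⟨h0, h1, h2, h3⟩
        exact ⟨h1, by omega, by omega⟩)
  have hneg := sum_eq_sum_add_sum_of_snoc (k := k) hq (A := negExponents k m)
    (B := negExponents (k + 1) m) (C := negExponents (k + 1) (m - 1)) (-1) (-1)
    (fun b => by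
      rw [snoc_mem_negExponents, mem_negExponents]
      constructor
      · rintro ⟨h1, h2⟩
        exact ⟨h1, by omega, by omega⟩
      · rintro ⟨h1, h2, h3⟩
        exact ⟨h1, by omega⟩)
    (fun b x => by
      rw [snoc_mem_negExponents, snoc_mem_negExponents]
      constructor
      · rintro ⟨h1, h2, h3⟩
        exact ⟨by omega, h1, by omega, by omega⟩
      · rintro ⟨h0, h1, h2, h3⟩
        exact ⟨h1, by omega, by omega⟩)
  have hq1 : q ^ (((k : ℤ) + 1) * 1) = q ^ (k + 1) := by
    rw [mul_one]; exact_mod_cast zpow_natCast q (k + 1)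
  have hq2 : q ^ (((k : ℤ) + 1) * (-1)) = (q ^ (k + 1))⁻¹ := by
    rw [mul_neg, zpow_neg, hq1]
  have hq3 : q ^ (k + 1) ≠ 0 := pow_ne_zero _ hq
  rw [mul_zero, zpow_zero, one_mul, hq1] at hpos
  rw [hq2] at hneg
  rw [monomialCharacter, monomialCharacter, monomialCharacter, hpos, hneg]
  field_simp
  ring

theorem monomialCharacter_zero_right (k : ℕ) (q : ℂ) : monomialCharacter k 0 q = 1 := by
  have h1 : posExponents k 0 = {0} := by
    ext a
    rw [mem_posExponents, Finset.mem_singleton]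
    constructor
    · rintro ⟨h1, h2⟩
      rw [Finset.sum_eq_zero_iff_of_nonneg fun i _ => h1 i] at h2
      exact funext fun i => h2 i (Finset.mem_univ i)
    · rintro rfl
      simp
  have h2 : negExponents k 0 = ∅ := by
    refine Finset.eq_empty_of_forall_notMem fun a ha => ?_
    obtain ⟨h1, h2⟩ := mem_negExponents.1 ha
    exact (Finset.sum_neg (fun i _ => h1 i) Finset.univ_nonempty).ne h2
  simp [monomialCharacter, h1, h2, exponentWeight]

theorem monomialCharacter_zero_left (m : ℤ) (q : ℂ) : monomialCharacter 0 m q = 1 := by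
  have hw : ∀ a : Fin (0 + 1) → ℤ, exponentWeight a = 0 := fun a => by simp [exponentWeight]
  have hex : ∀ a : Fin (0 + 1) → ℤ, ∑ i, a i = m ↔ a = fun _ => m := by
    intro a
    rw [Fin.sum_univ_castSucc]
    simp [funext_iff, Fin.forall_fin_one]
  simp only [monomialCharacter, hw, zpow_zero, Finset.sum_const, pow_zero, one_mul]
  rcases le_or_gt 0 m with hm | hm
  · have h1 : posExponents 0 m = {fun _ => m} := by
      ext a
      rw [mem_posExponents, Finset.mem_singleton, hex]
      exact ⟨fun h => h.2, fun h => ⟨fun i => by rw [h]; exact hm, h⟩⟩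
    have h2 : negExponents 0 m = ∅ := by
      refine Finset.eq_empty_of_forall_notMem fun a ha => ?_
      obtain ⟨h1, h2⟩ := mem_negExponents.1 ha
      have := h1 0
      rw [(hex a).1 h2] at this
      exact absurd this (by simpa using hm)
    simp [h1, h2]
  · have h1 : negExponents 0 m = {fun _ => m} := by
      ext a
      rw [mem_negExponents, Finset.mem_singleton, hex]
      exact ⟨fun h => h.2, fun h => ⟨fun i => by rw [h]; exact hm, h⟩⟩
    have h2 : posExponents 0 m = ∅ := by
      refine Finset.eq_empty_of_forall_notMem fun a ha => ?_
      obtain ⟨h1, h2⟩ := mem_posExponents.1 ha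
      have := h1 0
      rw [(hex a).1 h2] at this
      exact absurd this (by simpa using hm)
    simp [h1, h2]

/-- The Pascal rule determines a function on `ℕ × ℤ` by its values on the two axes. -/
theorem eq_of_pascal {q : ℂ} (hq : q ≠ 0) {K : ℕ} {X Y : ℕ → ℤ → ℂ}
    (hX : ∀ k < K, ∀ m, X (k + 1) m = X k m + q ^ (k + 1) * X (k + 1) (m - 1))
    (hY : ∀ k < K, ∀ m, Y (k + 1) m = Y k m + q ^ (k + 1) * Y (k + 1) (m - 1))
    (h0 : ∀ m, X 0 m = Y 0 m) (h : ∀ k ≤ K, X k 0 = Y k 0) :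
    ∀ k ≤ K, ∀ m, X k m = Y k m := by
  intro k
  induction k with
  | zero => exact fun _ m => h0 m
  | succ k ih =>
    intro hk m
    have ih' := ih (Nat.le_of_succ_le hk)
    have hc : q ^ (k + 1) ≠ 0 := pow_ne_zero _ hq
    induction m using Int.induction_on with
    | zero => exact h _ hk
    | succ n ihn => rw [hX k hk, hY k hk, ih', add_sub_cancel_right, ihn]
    | pred n ihn =>
      rw [hX k hk, hY k hk, ih'] at ihn
      exact mul_left_cancel₀ hc (add_left_cancel ihn)

/-- The Pascal rule for Gaussian binomial coefficients with an arbitrary integral upper entry. -/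
theorem gaussBinom_succ (k : ℕ) (m : ℤ) {q : ℂ} (hq0 : q ≠ 0)
    (hq : ∀ i ∈ Finset.Icc 1 (k + 1), q ^ i ≠ 1) :
    gaussBinom (m + (k + 1 : ℕ)) (k + 1) q =
      gaussBinom (m + k) k q + q ^ (k + 1) * gaussBinom (m - 1 + (k + 1 : ℕ)) (k + 1) q := by
  have hD : ∀ i ≤ k, 1 - q ^ (i + 1) ≠ 0 := fun i hi =>
    sub_ne_zero.2 (hq (i + 1) (Finset.mem_Icc.2 ⟨by omega, by omega⟩)).symm
  have hD' : ∏ i ∈ Finset.range k, (1 - q ^ (i + 1)) ≠ 0 :=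
    Finset.prod_ne_zero_iff.2 fun i hi => hD i (Finset.mem_range.1 hi).le
  have hN1 : ∏ i ∈ Finset.range (k + 1), (1 - q ^ (m + (k + 1 : ℕ) - (i : ℤ))) =
      (∏ i ∈ Finset.range k, (1 - q ^ (m + k - (i : ℤ)))) * (1 - q ^ m * q ^ (k + 1)) := by
    rw [Finset.prod_range_succ']
    congr 1
    · refine Finset.prod_congr rfl fun i _ => ?_
      congr 2
      push_cast
      ring
    · rw [← zpow_natCast q (k + 1), ← zpow_add₀ hq0]
      simp
  have hN2 : ∏ i ∈ Finset.range (k + 1), (1 - q ^ (m - 1 + (k + 1 : ℕ) - (i : ℤ))) =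
      (∏ i ∈ Finset.range k, (1 - q ^ (m + k - (i : ℤ)))) * (1 - q ^ m) := by
    rw [Finset.prod_range_succ]
    congr 1
    · refine Finset.prod_congr rfl fun i _ => ?_
      congr 2
      push_cast
      ring
    · congr 2
      push_cast
      ring
  rw [gaussBinom, gaussBinom, gaussBinom, hN1, hN2, Finset.prod_range_succ _ k]
  have := hD k le_rfl
  field_simp
  ring

theorem gaussBinom_self (k : ℕ) {q : ℂ} (hq : ∀ i ∈ Finset.Icc 1 k, q ^ i ≠ 1) :
    gaussBinom k k q = 1 := by
  have hD : ∏ i ∈ Finset.range k, (1 - q ^ (i + 1)) ≠ 0 :=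
    Finset.prod_ne_zero_iff.2 fun i hi => sub_ne_zero.2
      (hq (i + 1) (Finset.mem_Icc.2 ⟨by omega, by have := Finset.mem_range.1 hi; omega⟩)).symm
  rw [gaussBinom, div_eq_one_iff_eq hD, ← Finset.prod_range_reflect]
  refine Finset.prod_congr rfl fun i hi => ?_
  have := Finset.mem_range.1 hi
  rw [← zpow_natCast q (i + 1)]
  congr 2
  push_cast [Nat.cast_sub (show i ≤ k - 1 by omega), Nat.cast_sub (show 1 ≤ k by omega)]
  ring

theorem monomialCharacter_eq_gaussBinom (k : ℕ) (m : ℤ) {q : ℂ} (hq0 : q ≠ 0)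
    (hq : ∀ i ∈ Finset.Icc 1 k, q ^ i ≠ 1) :
    monomialCharacter k m q = gaussBinom (m + k) k q := by
  have hq' : ∀ j ≤ k, ∀ i ∈ Finset.Icc 1 j, q ^ i ≠ 1 := fun j hj i hi =>
    hq i (Finset.Icc_subset_Icc_right hj hi)
  refine eq_of_pascal hq0 (K := k) (X := fun k m => monomialCharacter k m q)
    (Y := fun k m => gaussBinom (m + k) k q) (fun j _ m => monomialCharacter_succ j m hq0)
    (fun j hj m => gaussBinom_succ j m hq0 (hq' _ hj)) (fun m => ?_) (fun j hj => ?_) k le_rfl m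
  · simp [monomialCharacter_zero_left, gaussBinom]
  · simp only [monomialCharacter_zero_right, zero_add, gaussBinom_self j (hq' j hj)]

theorem monomialCharacter_one (k : ℕ) (m : ℤ) :
    monomialCharacter k m 1 = (Ring.choose (m + k) k : ℤ) := by
  refine eq_of_pascal one_ne_zero (K := k) (X := fun k m => monomialCharacter k m 1)
    (Y := fun k m => ((Ring.choose (m + k) k : ℤ) : ℂ))
    (fun j _ m => monomialCharacter_succ j m one_ne_zero) (fun j _ m => ?_) (fun m => ?_)
    (fun j hj => ?_) k le_rfl m
  · have h1 := Ring.choose_succ_succ (m + j) j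
    have e1 : m + ((j + 1 : ℕ) : ℤ) = m + j + 1 := by push_cast; ring
    have e2 : m - 1 + ((j + 1 : ℕ) : ℤ) = m + j := by push_cast; ring
    rw [one_pow, one_mul, e1, e2, h1]
    push_cast
    ring
  · simp [monomialCharacter_zero_left]
  · simp [monomialCharacter_zero_right, Ring.choose_natCast]

theorem continuousAt_monomialCharacter (k : ℕ) (m : ℤ) {q : ℂ} (hq : q ≠ 0) :
    ContinuousAt (monomialCharacter k m) q := by
  have h : ∀ W : Finset (Fin (k + 1) → ℤ),
      ContinuousAt (fun q : ℂ => ∑ a ∈ W, q ^ exponentWeight a) q := fun W =>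
    tendsto_finsetSum _ fun a _ => continuousAt_zpow₀ q _ (Or.inl hq)
  exact (h _).add (continuousAt_const.mul (h _))

/-- Near a nonzero `q₀`, the Gaussian binomial coefficient agrees with the character outside the
finitely many zeros of its denominator. -/
theorem tendsto_gaussBinom (k : ℕ) (m : ℤ) {q₀ : ℂ} (hq₀ : q₀ ≠ 0) :
    Filter.Tendsto (gaussBinom (m + k) k) (𝓝[≠] q₀) (𝓝 (monomialCharacter k m q₀)) := by
  refine ((continuousAt_monomialCharacter k m hq₀).tendsto.mono_left
    nhdsWithin_le_nhds).congr' ?_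
  have h0 : ∀ᶠ q in 𝓝[≠] q₀, q ≠ 0 := nhdsWithin_le_nhds (isOpen_ne.mem_nhds hq₀)
  have h1 : ∀ᶠ q in 𝓝[≠] q₀, ∀ i ∈ Finset.Icc 1 k, q ^ i ≠ 1 := by
    rw [Filter.eventually_all_finset]
    intro i hi
    have hi0 : 0 < i := (Finset.mem_Icc.1 hi).1
    have hfin : {q : ℂ | q ^ i = 1}.Finite := by
      refine ((Polynomial.nthRoots i (1 : ℂ)).toFinset.finite_toSet).subset fun q hq => ?_
      simpa [Polynomial.mem_nthRoots hi0] using hq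
    have := (hfin.subset (Set.sdiff_subset (t := {q₀}))).isClosed.isOpen_compl
      |>.mem_nhds (x := q₀) (by simp)
    filter_upwards [nhdsWithin_le_nhds this, self_mem_nhdsWithin] with q hq hne h
    exact hq ⟨h, hne⟩
  filter_upwards [h0, h1] with q hq0 hq using monomialCharacter_eq_gaussBinom k m hq0 hq

/-! ### Vortex configurations and polynomials -/

section

open Polynomial

theorem mk_eq_mk_iff_mul_eq_mul {k : ℕ} {v w : Fin (k + 1) → ℂ} (hv : v ≠ 0) (hw : w ≠ 0) :
    Projectivization.mk ℂ v hv = Projectivization.mk ℂ w hw ↔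
      ∀ i j, v i * w j = v j * w i := by
  rw [Projectivization.mk_eq_mk_iff']
  constructor
  · rintro ⟨a, rfl⟩ i j
    simp only [Pi.smul_apply, smul_eq_mul]
    ring
  · intro h
    obtain ⟨j, hj⟩ := Function.ne_iff.1 hw
    refine ⟨v j / w j, funext fun i => ?_⟩
    have hj' : w j ≠ 0 := hj
    have := h i j
    simp only [Pi.smul_apply, smul_eq_mul]
    field_simp
    linear_combination -this

theorem isOpenQuotientMap_mk' (k : ℕ) : IsOpenQuotientMap
    (Projectivization.mk' ℂ : {w : Fin (k + 1) → ℂ // w ≠ 0} → CP k) := by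
  refine ⟨fun p => ⟨⟨p.rep, p.rep_nonzero⟩, p.mk_rep⟩, continuous_coinduced_rng, fun U hU => ?_⟩
  change IsOpen (Projectivization.mk' ℂ ⁻¹' (Projectivization.mk' ℂ '' U))
  let act : ℂˣ → {w : Fin (k + 1) → ℂ // w ≠ 0} → {w : Fin (k + 1) → ℂ // w ≠ 0} :=
    fun t w => ⟨t • w.1, smul_ne_zero t.ne_zero w.2⟩
  have hact : ∀ t, Continuous (act t) := fun t =>
    (continuous_subtype_val.const_smul (t : ℂ)).subtype_mk _
  have : Projectivization.mk' ℂ ⁻¹' (Projectivization.mk' ℂ '' U) = ⋃ t, act t ⁻¹' U := by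
    ext w
    simp only [Set.mem_preimage, Set.mem_image, Set.mem_iUnion]
    constructor
    · rintro ⟨v, hv, hvw⟩
      obtain ⟨t, ht⟩ := (Projectivization.mk_eq_mk_iff ℂ _ _ v.2 w.2).1 hvw
      refine ⟨t, ?_⟩
      have : act t w = v := Subtype.ext ht
      rwa [this]
    · rintro ⟨t, ht⟩
      exact ⟨act t w, ht, (Projectivization.mk_eq_mk_iff ℂ _ _ (act t w).2 w.2).2 ⟨t, rfl⟩⟩
  rw [this]
  exact isOpen_iUnion fun t => hU.preimage (hact t)

instance t2Space_CP (k : ℕ) : T2Space (CP k) := by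
  rw [t2Space_iff_of_isOpenQuotientMap (isOpenQuotientMap_mk' k)]
  have : {q : {w : Fin (k + 1) → ℂ // w ≠ 0} × {w : Fin (k + 1) → ℂ // w ≠ 0} |
      Projectivization.mk' ℂ q.1 = Projectivization.mk' ℂ q.2} =
      ⋂ i, ⋂ j, {q | q.1.1 i * q.2.1 j = q.1.1 j * q.2.1 i} := by
    ext q
    simp only [Set.mem_iInter]
    exact mk_eq_mk_iff_mul_eq_mul q.1.2 q.2.2
  have hc : ∀ i, Continuous fun w : {w : Fin (k + 1) → ℂ // w ≠ 0} => w.1 i := fun i =>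
    (continuous_apply i).comp continuous_subtype_val
  rw [this]
  exact isClosed_iInter fun i => isClosed_iInter fun j =>
    isClosed_eq ((hc i).comp continuous_fst |>.mul ((hc j).comp continuous_snd))
      ((hc j).comp continuous_fst |>.mul ((hc i).comp continuous_snd))

instance compactSpace_CP (k : ℕ) : CompactSpace (CP k) := by
  have hne : ∀ w : Metric.sphere (0 : Fin (k + 1) → ℂ) 1, w.1 ≠ 0 := fun w =>
    ne_zero_of_mem_unit_sphere w
  let g : Metric.sphere (0 : Fin (k + 1) → ℂ) 1 → CP k := fun w =>
    Projectivization.mk' ℂ ⟨w.1, hne w⟩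
  have hg : Continuous g :=
    (isOpenQuotientMap_mk' k).continuous.comp (continuous_subtype_val.subtype_mk _)
  have hsurj : Function.Surjective g := by
    intro p
    have hp : ‖p.rep‖ ≠ 0 := norm_ne_zero_iff.2 p.rep_nonzero
    refine ⟨⟨((‖p.rep‖⁻¹ : ℝ) : ℂ) • p.rep, by simp [norm_smul, hp]⟩, ?_⟩
    conv_rhs => rw [← p.mk_rep]
    exact (Projectivization.mk_eq_mk_iff' ℂ _ _ _ _).2 ⟨_, rfl⟩
  exact ⟨by rw [← hsurj.range_eq]; exact isCompact_range hg⟩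

theorem unordered_surjective {X : Type} (k : ℕ) :
    Function.Surjective (unordered : (Fin k → X) → Sym X k) := by
  rintro ⟨s, hs⟩
  subst hs
  induction s using Quotient.inductionOn with
  | h l =>
    refine ⟨fun i : Fin l.length => l.get i, Subtype.ext ?_⟩
    change Multiset.map (fun i : Fin l.length => l.get i) (Finset.univ : Finset (Fin l.length)).val
      = (l : Multiset X)
    rw [Fin.univ_val_map]
    simp

instance compactSpace_vortexModuli (k : ℕ) : CompactSpace (VortexModuli k) := by
  let u : (Fin k → CP 1) → VortexModuli k := unordered
  have hc : Continuous u := continuous_coinduced_rng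
  have hs : Function.Surjective u := unordered_surjective k
  exact ⟨by rw [← hs.range_eq]; exact isCompact_range hc⟩

/-- The linear polynomial `b z - a` with zero `a / b`. -/
def linearFactor (v : Fin 2 → ℂ) : ℂ[X] := C (v 1) * X - C (v 0)

theorem linearFactor_smul (a : ℂ) (v : Fin 2 → ℂ) :
    linearFactor (a • v) = C a * linearFactor v := by
  simp [linearFactor]
  ring

theorem natDegree_linearFactor_le (v : Fin 2 → ℂ) : (linearFactor v).natDegree ≤ 1 := by
  unfold linearFactor
  compute_degree

theorem linearFactor_ne_zero {v : Fin 2 → ℂ} (hv : v ≠ 0) : linearFactor v ≠ 0 := by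
  intro h
  apply hv
  have h1 := congrArg (fun P => P.coeff 1) h
  have h0 := congrArg (fun P => P.coeff 0) h
  simp [linearFactor] at h0 h1
  ext i
  fin_cases i
  · simpa using h0
  · simpa using h1

theorem associated_linearFactor_rep {v : Fin 2 → ℂ} (hv : v ≠ 0) :
    Associated (linearFactor (Projectivization.mk ℂ v hv).rep) (linearFactor v) := by
  obtain ⟨a, ha⟩ := Projectivization.exists_smul_eq_mk_rep ℂ v hv
  rw [← ha, Units.smul_def, linearFactor_smul]
  exact associated_unit_mul_left _ _ (isUnit_C.2 a.isUnit)

theorem eq_of_associated_linearFactor {p p' : CP 1}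
    (h : Associated (linearFactor p.rep) (linearFactor p'.rep)) : p = p' := by
  obtain ⟨u, hu⟩ := h
  obtain ⟨c, hc, hcu⟩ := Polynomial.isUnit_iff.1 u.isUnit
  rw [← hcu] at hu
  have h1 := congrArg (fun P => P.coeff 1) hu
  have h0 := congrArg (fun P => P.coeff 0) hu
  simp [linearFactor] at h0 h1
  rw [← p.mk_rep, ← p'.mk_rep, Projectivization.mk_eq_mk_iff']
  refine ⟨c⁻¹, ?_⟩
  have hc0 : c ≠ 0 := hc.ne_zero
  ext i
  fin_cases i
  · simp [← h0]; field_simp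
  · simp [← h1]; field_simp

/-- The polynomial with the given zeros on the Riemann sphere, up to a constant factor. -/
def divisorPoly (s : Multiset (CP 1)) : ℂ[X] := (s.map fun p => linearFactor p.rep).prod

theorem divisorPoly_cons (p : CP 1) (s : Multiset (CP 1)) :
    divisorPoly (p ::ₘ s) = linearFactor p.rep * divisorPoly s := by
  simp [divisorPoly]

theorem divisorPoly_ne_zero (s : Multiset (CP 1)) : divisorPoly s ≠ 0 := by
  refine Multiset.prod_ne_zero fun h => ?_
  obtain ⟨p, _, hp⟩ := Multiset.mem_map.1 h
  exact linearFactor_ne_zero p.rep_nonzero hp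

theorem natDegree_divisorPoly_le (s : Multiset (CP 1)) : (divisorPoly s).natDegree ≤ s.card := by
  induction s using Multiset.induction_on with
  | empty => simp [divisorPoly]
  | cons p s ih =>
    rw [divisorPoly_cons, Multiset.card_cons]
    have := natDegree_linearFactor_le p.rep
    have := natDegree_mul_le (p := linearFactor p.rep) (q := divisorPoly s)
    omega

/-- The degree drops exactly when the point at infinity belongs to the divisor. -/
theorem exists_rep_one_eq_zero {s : Multiset (CP 1)} (h : (divisorPoly s).natDegree < s.card) :
    ∃ p ∈ s, p.rep 1 = 0 := by
  by_contra hno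
  push Not at hno
  refine h.ne ?_
  have h1 : (divisorPoly s).natDegree = ((s.map fun p => linearFactor p.rep).map natDegree).sum :=
    natDegree_multiset_prod _ fun h0 => by
      obtain ⟨p, _, hp⟩ := Multiset.mem_map.1 h0
      exact linearFactor_ne_zero p.rep_nonzero hp
  rw [h1, Multiset.map_map, Multiset.map_congr rfl (g := fun _ => 1)]
  · simp
  · intro p hp
    have := hno p hp
    simp only [Function.comp_apply, linearFactor]
    compute_degree!

/-- A finite point of a divisor is a zero of its polynomial, and infinity is detected by the drop in
degree. -/
theorem mem_of_associated_divisorPoly {p : CP 1} {s t : Multiset (CP 1)} (hp : p ∈ s)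
    (hcard : s.card = t.card) (h : Associated (divisorPoly s) (divisorPoly t)) : p ∈ t := by
  have hdvd : linearFactor p.rep ∣ divisorPoly t :=
    (Multiset.dvd_prod (Multiset.mem_map_of_mem (fun p : CP 1 => linearFactor p.rep) hp)).trans
      h.dvd
  by_cases hb : p.rep 1 = 0
  · have hlt : (divisorPoly t).natDegree < t.card := by
      have hdeg : (divisorPoly s).natDegree = (divisorPoly t).natDegree :=
        natDegree_eq_of_degree_eq (degree_eq_degree_of_associated h)
      rw [← hcard, ← hdeg]
      obtain ⟨s', rfl⟩ := Multiset.exists_cons_of_mem hp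
      have h1 := natDegree_divisorPoly_le s'
      have h2 : linearFactor p.rep = C (-p.rep 0) := by simp [linearFactor, hb]
      have h3 := natDegree_C_mul_le (-p.rep 0) (divisorPoly s')
      rw [divisorPoly_cons, h2, Multiset.card_cons]
      omega
    obtain ⟨p', hp', hb'⟩ := exists_rep_one_eq_zero hlt
    have : p = p' := by
      rw [← p.mk_rep, ← p'.mk_rep, mk_eq_mk_iff_mul_eq_mul]
      intro i j
      fin_cases i <;> fin_cases j <;> simp [hb, hb', mul_comm]
    rwa [this]
  · have hirr : Irreducible (linearFactor p.rep) := by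
      refine irreducible_of_degree_eq_one ?_
      unfold linearFactor
      compute_degree!
    obtain ⟨p', hp', hdQ⟩ := Prime.exists_mem_multiset_map_dvd hirr.prime hdvd
    have : p = p' := by
      refine eq_of_associated_linearFactor
        (associated_of_dvd_of_natDegree_le hdQ (linearFactor_ne_zero p'.rep_nonzero) ?_)
      refine (natDegree_linearFactor_le _).trans ?_
      have : (linearFactor p.rep).natDegree = 1 := by
        unfold linearFactor
        compute_degree!
      rw [this]
    rwa [this]

/-- An effective divisor is determined by its polynomial. -/
theorem eq_of_associated_divisorPoly {s t : Multiset (CP 1)} (hcard : s.card = t.card)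
    (h : Associated (divisorPoly s) (divisorPoly t)) : s = t := by
  induction s using Multiset.induction_on generalizing t with
  | empty => exact (Multiset.card_eq_zero.1 hcard.symm).symm
  | cons p s ih =>
    obtain ⟨t, rfl⟩ := Multiset.exists_cons_of_mem
      (mem_of_associated_divisorPoly (Multiset.mem_cons_self p s) hcard h)
    rw [divisorPoly_cons, divisorPoly_cons] at h
    rw [ih (by simpa using hcard)
      (h.of_mul_left (Associated.refl _) (linearFactor_ne_zero p.rep_nonzero))]

theorem associated_multiset_prod {α M : Type*} [CommMonoid M] {f g : α → M} (s : Multiset α)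
    (h : ∀ a ∈ s, Associated (f a) (g a)) : Associated (s.map f).prod (s.map g).prod := by
  induction s using Multiset.induction_on with
  | empty => simp
  | cons a s ih =>
    rw [Multiset.map_cons, Multiset.map_cons, Multiset.prod_cons, Multiset.prod_cons]
    exact (h a (Multiset.mem_cons_self a s)).mul_mul
      (ih fun b hb => h b (Multiset.mem_cons_of_mem hb))

/-- Every nonzero polynomial of degree at most `k` comes from a divisor of degree `k`: zeros at
infinity make up for a drop in degree. -/
theorem exists_associated_divisorPoly {k : ℕ} {P : ℂ[X]} (hP : P ≠ 0) (hk : P.natDegree ≤ k) :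
    ∃ s : Multiset (CP 1), s.card = k ∧ Associated (divisorPoly s) P := by
  have hfin : ∀ r : ℂ, (![r, 1] : Fin 2 → ℂ) ≠ 0 := fun r h => by simpa using congrFun h 1
  have hinf : (![1, 0] : Fin 2 → ℂ) ≠ 0 := fun h => by simpa using congrFun h 0
  have hsplit : P.Splits := IsAlgClosed.splits P
  have hroots : P.roots.card = P.natDegree := hsplit.natDegree_eq_card_roots.symm
  refine ⟨P.roots.map (fun r => Projectivization.mk ℂ ![r, 1] (hfin r)) +
    Multiset.replicate (k - P.natDegree) (Projectivization.mk ℂ ![1, 0] hinf), ?_, ?_⟩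
  · simp [hroots]
    omega
  · rw [divisorPoly, Multiset.map_add, Multiset.prod_add, Multiset.map_map,
      Multiset.map_replicate, Multiset.prod_replicate]
    have h1 : Associated (P.roots.map ((fun p : CP 1 => linearFactor p.rep) ∘
        fun r => Projectivization.mk ℂ ![r, 1] (hfin r))).prod
        (P.roots.map fun r => X - C r).prod := by
      refine associated_multiset_prod _ fun r _ => ?_
      have := associated_linearFactor_rep (hfin r)
      simpa [linearFactor] using this
    have h2 : Associated (linearFactor (Projectivization.mk ℂ ![1, 0] hinf).rep ^
        (k - P.natDegree)) 1 := by
      have h3 := associated_linearFactor_rep hinf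
      have h4 : linearFactor ![1, 0] = C (-1) := by simp [linearFactor]
      rw [h4] at h3
      have h5 : Associated (C (-1 : ℂ)) 1 := associated_one_iff_isUnit.2 (isUnit_C.2 (by simp))
      simpa using (h3.trans h5).pow_pow (n := k - P.natDegree)
    have h3 : Associated (P.roots.map fun r => X - C r).prod P := by
      conv_rhs => rw [hsplit.eq_prod_roots]
      exact (associated_unit_mul_left _ _
        (isUnit_C.2 (leadingCoeff_ne_zero.2 hP).isUnit)).symm
    simpa using (h1.trans h3).mul_mul h2

/-- The homogeneous coordinates of a polynomial of degree at most `k`: its coefficients, from the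
top one down. -/
def polyCoords (k : ℕ) (P : ℂ[X]) : Fin (k + 1) → ℂ := fun j => P.coeff (k - (j : ℕ))

theorem polyCoords_injective {k : ℕ} {P Q : ℂ[X]} (hP : P.natDegree ≤ k) (hQ : Q.natDegree ≤ k)
    (h : polyCoords k P = polyCoords k Q) : P = Q := by
  ext n
  by_cases hn : n ≤ k
  · have := congrFun h ⟨k - n, by omega⟩
    simp only [polyCoords] at this
    rwa [Nat.sub_sub_self hn] at this
  · rw [coeff_eq_zero_of_natDegree_lt (by omega), coeff_eq_zero_of_natDegree_lt (by omega)]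

theorem polyCoords_ne_zero {k : ℕ} {P : ℂ[X]} (hP : P.natDegree ≤ k) (h0 : P ≠ 0) :
    polyCoords k P ≠ 0 := fun h => h0 (polyCoords_injective hP (by simp) (by
      rw [h]; funext j; simp [polyCoords]))

theorem mk_polyCoords_eq_iff {k : ℕ} {P Q : ℂ[X]} (hP : P.natDegree ≤ k) (hQ : Q.natDegree ≤ k)
    (hP0 : polyCoords k P ≠ 0) (hQ0 : polyCoords k Q ≠ 0) :
    Projectivization.mk ℂ (polyCoords k P) hP0 = Projectivization.mk ℂ (polyCoords k Q) hQ0 ↔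
      Associated P Q := by
  rw [Projectivization.mk_eq_mk_iff]
  constructor
  · rintro ⟨a, ha⟩
    have h1 : C (a : ℂ) * Q = P := by
      refine polyCoords_injective ((natDegree_C_mul_le _ _).trans hQ) hP (Eq.trans ?_ ha)
      funext j
      simp [polyCoords, Units.smul_def]
    rw [← h1]
    exact associated_unit_mul_left _ _ (isUnit_C.2 a.isUnit)
  · intro h
    obtain ⟨u, rfl⟩ := h.symm
    obtain ⟨c, hc, hcu⟩ := Polynomial.isUnit_iff.1 u.isUnit
    refine ⟨hc.unit, ?_⟩
    funext j
    simp [polyCoords, ← hcu, Units.smul_def, mul_comm]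

theorem natDegree_prod_linearFactor_le {k : ℕ} (v : Fin k → Fin 2 → ℂ) :
    (∏ i, linearFactor (v i)).natDegree ≤ k := by
  refine (natDegree_prod_le _ _).trans ?_
  refine (Finset.sum_le_sum fun i _ => natDegree_linearFactor_le (v i)).trans ?_
  simp

theorem vortexCoords_ne_zero {k : ℕ} {v : Fin k → Fin 2 → ℂ} (hv : ∀ i, v i ≠ 0) :
    vortexCoords v ≠ 0 :=
  polyCoords_ne_zero (natDegree_prod_linearFactor_le v)
    (Finset.prod_ne_zero_iff.2 fun i _ => linearFactor_ne_zero (hv i))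

theorem natDegree_divisorPoly_sym_le {k : ℕ} (D : Sym (CP 1) k) :
    (divisorPoly D.1).natDegree ≤ k :=
  (natDegree_divisorPoly_le D.1).trans_eq D.2

/-- The map from vortex configurations to `ℂP^k` by coefficients of polynomials. -/
def vortexMap (k : ℕ) (D : VortexModuli k) : CP k :=
  Projectivization.mk ℂ (polyCoords k (divisorPoly D.1))
    (polyCoords_ne_zero (natDegree_divisorPoly_sym_le D) (divisorPoly_ne_zero _))

theorem vortexMap_unordered {k : ℕ} {v : Fin k → Fin 2 → ℂ} (hv : ∀ i, v i ≠ 0) :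
    vortexMap k (unordered fun i => Projectivization.mk ℂ (v i) (hv i)) =
      Projectivization.mk ℂ (vortexCoords v) (vortexCoords_ne_zero hv) := by
  have h : Associated
      (divisorPoly (unordered fun i => Projectivization.mk ℂ (v i) (hv i)).1)
      (∏ i, linearFactor (v i)) := by
    rw [divisorPoly, unordered, Multiset.map_map]
    exact associated_multiset_prod _ fun i _ => associated_linearFactor_rep (hv i)
  exact (mk_polyCoords_eq_iff (natDegree_divisorPoly_sym_le _)
    (natDegree_prod_linearFactor_le v) (polyCoords_ne_zero (natDegree_divisorPoly_sym_le _)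
      (divisorPoly_ne_zero _)) (vortexCoords_ne_zero hv)).2 h

theorem vortexMap_bijective (k : ℕ) : Function.Bijective (vortexMap k) := by
  constructor
  · intro D D' h
    have h1 := (mk_polyCoords_eq_iff (natDegree_divisorPoly_sym_le D)
      (natDegree_divisorPoly_sym_le D') _ _).1 h
    exact Subtype.ext (eq_of_associated_divisorPoly (D.2.trans D'.2.symm) h1)
  · intro p
    set P : ℂ[X] := ∑ j : Fin (k + 1), C (p.rep j) * X ^ (k - (j : ℕ)) with hPdef
    have hcoeff : polyCoords k P = p.rep := by
      funext j
      rw [polyCoords, hPdef, finsetSum_coeff, Finset.sum_eq_single j]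
      · simp
      · intro i _ hij
        rw [coeff_C_mul_X_pow, if_neg]
        have := Fin.val_ne_of_ne hij
        omega
      · simp
    have hdeg : P.natDegree ≤ k := natDegree_sum_le_of_forall_le _ _ fun j _ =>
      (natDegree_C_mul_X_pow_le _ _).trans (Nat.sub_le _ _)
    have hP0 : P ≠ 0 := by
      intro h
      apply p.rep_nonzero
      rw [← hcoeff, h]
      funext j
      simp [polyCoords]
    obtain ⟨s, hs, hassoc⟩ := exists_associated_divisorPoly hP0 hdeg
    refine ⟨(⟨s, hs⟩ : Sym (CP 1) k), ?_⟩
    have h1 := (mk_polyCoords_eq_iff (natDegree_divisorPoly_sym_le ⟨s, hs⟩) hdeg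
      (polyCoords_ne_zero (natDegree_divisorPoly_sym_le ⟨s, hs⟩) (divisorPoly_ne_zero _))
      (polyCoords_ne_zero hdeg hP0)).2 hassoc
    refine h1.trans ?_
    conv_rhs => rw [← p.mk_rep]
    simp only [hcoeff]

theorem continuous_coeff_prod_linearFactor {κ : Type*} (s : Finset κ) (n : ℕ) :
    Continuous fun v : κ → Fin 2 → ℂ => (∏ i ∈ s, linearFactor (v i)).coeff n := by
  classical
  induction s using Finset.induction_on generalizing n with
  | empty => simpa using continuous_const
  | insert i s hi ih =>
    have h : ∀ v : κ → Fin 2 → ℂ, (∏ j ∈ insert i s, linearFactor (v j)).coeff n =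
        v i 1 * (X * ∏ j ∈ s, linearFactor (v j)).coeff n -
          v i 0 * (∏ j ∈ s, linearFactor (v j)).coeff n := by
      intro v
      rw [Finset.prod_insert hi, linearFactor, sub_mul, coeff_sub, mul_assoc, coeff_C_mul,
        coeff_C_mul]
    simp only [h]
    refine Continuous.sub (Continuous.mul (by fun_prop) ?_) (Continuous.mul (by fun_prop) (ih n))
    cases n with
    | zero => simpa using continuous_const
    | succ n => simpa using ih n

theorem continuous_vortexCoords (k : ℕ) :
    Continuous (vortexCoords : (Fin k → Fin 2 → ℂ) → Fin (k + 1) → ℂ) :=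
  continuous_pi fun _ => continuous_coeff_prod_linearFactor _ _

theorem continuous_vortexMap (k : ℕ) : Continuous (vortexMap k) := by
  refine continuous_coinduced_dom.2 ?_
  refine ((IsOpenQuotientMap.piMap fun _ : Fin k =>
    isOpenQuotientMap_mk' 1).continuous_comp_iff).1 ?_
  have h : (vortexMap k ∘ unordered) ∘ (Pi.map fun _ : Fin k => Projectivization.mk' ℂ) =
      fun v : Fin k → {w : Fin 2 → ℂ // w ≠ 0} => Projectivization.mk' ℂ
        ⟨vortexCoords fun i => (v i).1, vortexCoords_ne_zero fun i => (v i).2⟩ :=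
    funext fun v => vortexMap_unordered fun i => (v i).2
  rw [h]
  refine (isOpenQuotientMap_mk' k).continuous.comp (Continuous.subtype_mk ?_ _)
  exact (continuous_vortexCoords k).comp (by fun_prop)

/-- The moduli space of vortices is `ℂP^k`: a continuous bijection from a compact space to a
Hausdorff space is a homeomorphism. -/
def vortexHomeomorph (k : ℕ) : VortexModuli k ≃ₜ CP k :=
  Continuous.homeoOfEquivCompactToT2 (f := Equiv.ofBijective _ (vortexMap_bijective k))
    (continuous_vortexMap k)

/-- Replacing each `a_i` by `q a_i` rescales the coefficients. -/
theorem coeff_prod_linearFactor_rotationMap {κ : Type*} (q : Circle) (v : κ → Fin 2 → ℂ)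
    (s : Finset κ) (n : ℕ) :
    (q : ℂ) ^ n * (∏ i ∈ s, linearFactor (rotationMap q (v i))).coeff n =
      (q : ℂ) ^ s.card * (∏ i ∈ s, linearFactor (v i)).coeff n := by
  classical
  induction s using Finset.induction_on generalizing n with
  | empty =>
    cases n with
    | zero => simp
    | succ n => simp [coeff_one]
  | insert i s hi ih =>
    rw [Finset.prod_insert hi, Finset.prod_insert hi, Finset.card_insert_of_notMem hi,
      linearFactor, linearFactor, sub_mul, sub_mul, coeff_sub, coeff_sub, mul_assoc, mul_assoc,
      coeff_C_mul, coeff_C_mul, coeff_C_mul, coeff_C_mul]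
    have h1 : rotationMap q (v i) 1 = v i 1 := by simp [rotationMap]
    have h0 : rotationMap q (v i) 0 = q * v i 0 := by simp [rotationMap]
    rw [h1, h0]
    cases n with
    | zero =>
      have := ih 0
      simp only [coeff_X_mul_zero]
      linear_combination (-(q : ℂ) * v i 0) * this
    | succ n =>
      have e1 := ih n
      have e2 := ih (n + 1)
      rw [coeff_X_mul, coeff_X_mul]
      linear_combination (q * v i 1) * e1 - (q * v i 0) * e2

theorem vortexCoords_rotationMap {k : ℕ} (q : Circle) (v : Fin k → Fin 2 → ℂ) :
    vortexCoords (fun i => rotationMap q (v i)) = weightMap k q (vortexCoords v) := by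
  funext j
  have h := coeff_prod_linearFactor_rotationMap q v Finset.univ (k - (j : ℕ))
  have hq : (q : ℂ) ^ (k - (j : ℕ)) ≠ 0 := pow_ne_zero _ (Circle.coe_ne_zero q)
  refine mul_left_cancel₀ hq (h.trans ?_)
  rw [Finset.card_univ, Fintype.card_fin]
  have e : (q : ℂ) ^ k = (q : ℂ) ^ (k - (j : ℕ)) * (q : ℂ) ^ (j : ℕ) := by
    rw [← pow_add, Nat.sub_add_cancel (Nat.le_of_lt_succ j.2)]
  rw [e, mul_assoc]
  rfl

theorem vortexMap_rotateVortices {k : ℕ} (q : Circle) (D : VortexModuli k) :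
    vortexMap k (rotateVortices k q D) = weightAction k q (vortexMap k D) := by
  obtain ⟨x, rfl⟩ := unordered_surjective k D
  obtain ⟨v, hv, rfl⟩ : ∃ (v : Fin k → Fin 2 → ℂ) (hv : ∀ i, v i ≠ 0),
      x = fun i => Projectivization.mk ℂ (v i) (hv i) :=
    ⟨fun i => (x i).rep, fun i => (x i).rep_nonzero, funext fun i => (x i).mk_rep.symm⟩
  have hrot : ∀ i, rotationMap q (v i) ≠ 0 := fun i =>
    (map_ne_zero_iff _ (rotationMap_injective q)).2 (hv i)
  have h1 : rotateVortices k q (unordered fun i => Projectivization.mk ℂ (v i) (hv i)) =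
      unordered fun i => Projectivization.mk ℂ (rotationMap q (v i)) (hrot i) := by
    refine Subtype.ext ?_
    exact Multiset.map_map (rotateSphere q) _ (Finset.univ : Finset (Fin k)).val
  rw [h1, vortexMap_unordered, vortexMap_unordered, weightAction, Projectivization.map_mk]
  simp only [vortexCoords_rotationMap]

end

/-! ### Global sections on the sphere -/

theorem cone_univ (k : ℕ) : cone (Set.univ : Set (CP k)) = {w | w ≠ 0} := by
  ext w
  exact ⟨fun h => h.1, fun h => ⟨h, trivial⟩⟩

/-- The binary form `∑_j w_j x_0^(k-j) x_1^j`. -/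
def binaryForm {k : ℕ} (w : Fin (k + 1) → ℂ) (x : Fin 2 → ℂ) : ℂ :=
  ∑ j : Fin (k + 1), w j * x 0 ^ (k - (j : ℕ)) * x 1 ^ (j : ℕ)

theorem differentiable_binaryForm {k : ℕ} (w : Fin (k + 1) → ℂ) :
    Differentiable ℂ (binaryForm w) := by
  unfold binaryForm
  fun_prop

theorem binaryForm_smul {k : ℕ} (w : Fin (k + 1) → ℂ) (t : ℂ) (x : Fin 2 → ℂ) :
    binaryForm w (t • x) = t ^ (k : ℤ) * binaryForm w x := by
  rw [binaryForm, binaryForm, Finset.mul_sum]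
  refine Finset.sum_congr rfl fun j _ => ?_
  have e : t ^ k = t ^ (k - (j : ℕ)) * t ^ (j : ℕ) := by
    rw [← pow_add, Nat.sub_add_cancel (Nat.le_of_lt_succ j.2)]
  simp only [Pi.smul_apply, smul_eq_mul, mul_pow, zpow_natCast, e]
  ring

/-- The section of `𝒪(k)` on `ℂP¹` given by a binary form of degree `k`. -/
def binaryFormSection (k : ℕ) : (Fin (k + 1) → ℂ) →ₗ[ℂ] holSections 1 k Set.univ where
  toFun w := ⟨(cone Set.univ).indicator (binaryForm w), by
    refine ⟨(differentiable_binaryForm w).differentiableOn.congr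
      fun x hx => Set.indicator_of_mem hx _, fun t ht x hx => ?_,
      fun x hx => Set.indicator_of_notMem hx _⟩
    rw [Set.indicator_of_mem hx, Set.indicator_of_mem (smul_mem_cone ht hx), binaryForm_smul]⟩
  map_add' v w := by
    refine Subtype.ext ((congrArg _ (funext fun x => ?_)).trans (Set.indicator_add _ _ _))
    simp [binaryForm, add_mul, Finset.sum_add_distrib]
  map_smul' c w := by
    refine Subtype.ext ((congrArg _ (funext fun x => ?_)).trans
      (Set.indicator_const_smul (cone Set.univ) c (binaryForm w)))
    simp [binaryForm, mul_assoc, Finset.mul_sum]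

theorem binaryFormSection_apply {k : ℕ} (w : Fin (k + 1) → ℂ) {x : Fin 2 → ℂ} (hx : x ≠ 0) :
    (binaryFormSection k w).1 x = binaryForm w x :=
  Set.indicator_of_mem (cone_univ 1 ▸ hx) _

/-- The exponents of `x_0^(k-j) x_1^j`. -/
def binaryExponent {k : ℕ} (j : Fin (k + 1)) : Fin 2 → ℤ := ![((k - (j : ℕ) : ℕ) : ℤ), (j : ℕ)]

theorem binaryExponent_injective (k : ℕ) :
    Function.Injective (binaryExponent : Fin (k + 1) → Fin 2 → ℤ) := by
  intro i j h
  have := congrFun h 1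
  simp [binaryExponent] at this
  exact Fin.ext this

theorem exists_binaryExponent_eq {k : ℕ} {a : Fin 2 → ℤ} (h0 : 0 ≤ a 0) (h1 : 0 ≤ a 1)
    (h : ∑ i, a i = k) : ∃ j : Fin (k + 1), binaryExponent j = a := by
  rw [Fin.sum_univ_two] at h
  refine ⟨⟨(a 1).toNat, by omega⟩, funext fun i => ?_⟩
  fin_cases i
  · simp [binaryExponent]
    omega
  · simp [binaryExponent]
    omega

theorem laurentCoeff_binaryForm {k : ℕ} (w : Fin (k + 1) → ℂ) (a : Fin 2 → ℤ) :
    laurentCoeff (binaryForm w) a = ∑ j, if a = binaryExponent j then w j else 0 := by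
  have h : binaryForm w = ∑ j, w j • laurentMonomial (binaryExponent j) := by
    funext x
    rw [binaryForm, Finset.sum_apply]
    refine Finset.sum_congr rfl fun j _ => ?_
    simp only [laurentMonomial, binaryExponent, Pi.smul_apply, smul_eq_mul, Fin.prod_univ_two,
      Matrix.cons_val_zero, Matrix.cons_val_one, zpow_natCast]
    ring
  rw [h, laurentCoeff_sum]
  · refine Finset.sum_congr rfl fun j _ => ?_
    rw [laurentCoeff_smul, laurentCoeff_laurentMonomial]
    simp
  · intro j _
    exact (continuousOnTorus_laurentMonomial (binaryExponent j)).const_smul (w j)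

theorem laurentCoeff_binaryForm_binaryExponent {k : ℕ} (w : Fin (k + 1) → ℂ) (i : Fin (k + 1)) :
    laurentCoeff (binaryForm w) (binaryExponent i) = w i := by
  simp [laurentCoeff_binaryForm, (binaryExponent_injective k).eq_iff]

theorem nonvanishing_singleton_subset (i : Fin 2) :
    nonvanishing {i} ⊆ cone (Set.univ : Set (CP 1)) := by
  rw [cone_univ]
  rintro w hw rfl
  exact hw i (Finset.mem_singleton_self i) rfl

/-- The Laurent expansion of a global section has no negative exponents, since each variable may
vanish as long as the other one does not. -/
theorem laurentCoeff_eq_zero_of_global {k : ℕ} (s : holSections 1 k Set.univ) {a : Fin 2 → ℤ}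
    (ha : ∀ j : Fin (k + 1), binaryExponent j ≠ a) : laurentCoeff s.1 a = 0 := by
  have hd : ∀ i : Fin 2, DifferentiableOn ℂ s.1 (nonvanishing {i}) := fun i =>
    s.2.1.mono (nonvanishing_singleton_subset i)
  by_cases h : ∑ i, a i = k
  · rcases lt_or_ge (a 0) 0 with h0 | h0
    · exact laurentCoeff_eq_zero_of_neg (hd 1) (i := 0) (by simp) h0
    rcases lt_or_ge (a 1) 0 with h1 | h1
    · exact laurentCoeff_eq_zero_of_neg (hd 0) (i := 1) (by simp) h1
    obtain ⟨j, hj⟩ := exists_binaryExponent_eq h0 h1 h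
    exact (ha j hj).elim
  · refine laurentCoeff_eq_zero_of_homogeneous (fun t ht x => ?_) h
    exact s.2.2.1 t ht _ (nonvanishing_singleton_subset 0 (torusPt_mem_nonvanishing _ x))

theorem binaryFormSection_bijective (k : ℕ) : Function.Bijective (binaryFormSection k) := by
  constructor
  · intro v w h
    funext i
    rw [← laurentCoeff_binaryForm_binaryExponent v i, ← laurentCoeff_binaryForm_binaryExponent w i]
    refine laurentCoeff_congr (fun x => ?_) _
    have hx : torusPt x ≠ 0 := fun h0 => torusPt_apply_ne_zero x 0 (congrFun h0 0)
    rw [← binaryFormSection_apply v hx, ← binaryFormSection_apply w hx, h]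
  · intro s
    set w : Fin (k + 1) → ℂ := fun j => laurentCoeff s.1 (binaryExponent j) with hw
    refine ⟨w, Subtype.ext (funext fun x => ?_)⟩
    have hcoeff : ∀ a, laurentCoeff (binaryForm w) a = laurentCoeff s.1 a := by
      intro a
      by_cases ha : ∃ j : Fin (k + 1), binaryExponent j = a
      · obtain ⟨j, rfl⟩ := ha
        exact laurentCoeff_binaryForm_binaryExponent w j
      · push Not at ha
        rw [laurentCoeff_eq_zero_of_global s ha, laurentCoeff_binaryForm]
        exact Finset.sum_eq_zero fun j _ => if_neg (ha j).symm
    by_cases hx : x = 0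
    · have hx' : x ∉ cone (Set.univ : Set (CP 1)) := by rw [cone_univ]; simpa using hx
      rw [s.2.2.2 x hx']
      exact Set.indicator_of_notMem hx' _
    · rw [binaryFormSection_apply w hx]
      obtain ⟨i, hi⟩ := Function.ne_iff.1 hx
      exact eqOn_of_laurentCoeff_eq (S := {i}) (differentiable_binaryForm w).differentiableOn
        (s.2.1.mono (nonvanishing_singleton_subset i)) hcoeff (by simpa [nonvanishing] using hi)

theorem localAbelianHilbert_zero_genus (k : ℕ) (lam A : ℤ) :
    localAbelianHilbert 0 k lam A = Ring.choose (lam * (A - k) + k) k := by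
  simp [localAbelianHilbert]

theorem equivariantEuler_eq_gaussBinom (k : ℕ) (m : ℤ) {q : Circle}
    (hq : ∀ i ∈ Finset.Icc 1 k, (q : ℂ) ^ i ≠ 1) :
    equivariantEuler k m q = gaussBinom (m + k) k q := by
  rw [equivariantEuler_eq, monomialCharacter_eq_gaussBinom k m (Circle.coe_ne_zero q) hq]

theorem tendsto_gaussBinom_equivariantEuler (k : ℕ) (m : ℤ) (q : Circle) :
    Filter.Tendsto (gaussBinom (m + k) k) (𝓝[≠] (q : ℂ)) (𝓝 (equivariantEuler k m q)) := by
  rw [equivariantEuler_eq]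
  exact tendsto_gaussBinom k m (Circle.coe_ne_zero q)

theorem equivariantEuler_one_eq_choose (k : ℕ) (m : ℤ) :
    equivariantEuler k m 1 = (Ring.choose (m + k) k : ℤ) := by
  rw [equivariantEuler_eq, Circle.coe_one, monomialCharacter_one]

theorem continuous_equivariantEuler (k : ℕ) (m : ℤ) : Continuous (equivariantEuler k m) := by
  have h : equivariantEuler k m = fun q : Circle => monomialCharacter k m q :=
    funext (equivariantEuler_eq k m)
  rw [h]
  exact continuous_iff_continuousAt.2 fun q => ContinuousAt.comp (f := fun q : Circle => (q : ℂ))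
    (continuousAt_monomialCharacter k m (Circle.coe_ne_zero q)) (by fun_prop)

end HarmonicTrap

end

theorem mainTheorem4 (k : ℕ) :
    -- the moduli space is `ℂP^k`, and rotations act on it with weights `0, …, k`
    (∃ Φ : HarmonicTrap.VortexModuli k ≃ₜ HarmonicTrap.CP k,
      (∀ (v : Fin k → Fin 2 → ℂ) (hv : ∀ i, v i ≠ 0),
        ∃ hw : HarmonicTrap.vortexCoords v ≠ 0,
          Φ (HarmonicTrap.unordered fun i => Projectivization.mk ℂ (v i) (hv i)) =
            Projectivization.mk ℂ (HarmonicTrap.vortexCoords v) hw) ∧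
      ∀ (q : Circle) (D : HarmonicTrap.VortexModuli k),
        Φ (HarmonicTrap.rotateVortices k q D) = HarmonicTrap.weightAction k q (Φ D)) ∧
    -- the homogeneous coordinates are the coefficients of a holomorphic section of the line bundle
    -- of degree `k` on the sphere, so that `ℂP^k` is the projective space of such sections
    (∃ L : (Fin (k + 1) → ℂ) ≃ₗ[ℂ] HarmonicTrap.holSections 1 k Set.univ,
      ∀ (w : Fin (k + 1) → ℂ) (x : Fin 2 → ℂ), x ≠ 0 →
        (L w : (Fin 2 → ℂ) → ℂ) x =
          ∑ j : Fin (k + 1), w j * x 0 ^ (k - (j : ℕ)) * x 1 ^ (j : ℕ)) ∧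
    -- the equivariant index of `𝒪(λ d)`, `d = A - k`
    (∀ A lam : ℤ,
      (∀ p : ℕ, Module.Finite ℂ (HarmonicTrap.Cohomology k (lam * (A - k)) p)) ∧
      (∀ q : Circle, (∀ i ∈ Finset.Icc 1 k, (q : ℂ) ^ i ≠ 1) →
        HarmonicTrap.equivariantEuler k (lam * (A - k)) q =
          HarmonicTrap.gaussBinom (lam * (A - k) + k) k q) ∧
      (∀ q : Circle, Filter.Tendsto (HarmonicTrap.gaussBinom (lam * (A - k) + k) k) (𝓝[≠] (q : ℂ))
        (𝓝 (HarmonicTrap.equivariantEuler k (lam * (A - k)) q))) ∧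
      -- the limit `q → 1` is the genus zero case of the Hilbert polynomial
      Filter.Tendsto (HarmonicTrap.equivariantEuler k (lam * (A - k))) (𝓝[≠] 1)
        (𝓝 (HarmonicTrap.localAbelianHilbert 0 k lam A : ℂ)) ∧
      HarmonicTrap.equivariantEuler k (lam * (A - k)) 1 =
        (HarmonicTrap.localAbelianHilbert 0 k lam A : ℂ) ∧
      HarmonicTrap.eulerChar k (lam * (A - k)) = HarmonicTrap.localAbelianHilbert 0 k lam A) ∧
    -- the case `λ = 1`
    (∀ A : ℤ,
      (∀ q : Circle, (∀ i ∈ Finset.Icc 1 k, (q : ℂ) ^ i ≠ 1) →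
        HarmonicTrap.equivariantEuler k (A - k) q = HarmonicTrap.gaussBinom A k q) ∧
      ∀ q : Circle, Filter.Tendsto (HarmonicTrap.gaussBinom A k) (𝓝[≠] (q : ℂ))
        (𝓝 (HarmonicTrap.equivariantEuler k (A - k) q))) ∧
    -- Gaussian binomial coefficients tend to binomial coefficients as `q → 1`
    (∀ n : ℤ, Filter.Tendsto (HarmonicTrap.gaussBinom n k) (𝓝[≠] (1 : ℂ))
      (𝓝 ((Ring.choose n k : ℤ) : ℂ))) := by
  open HarmonicTrap in
  refine ⟨⟨vortexHomeomorph k, fun v hv => ⟨vortexCoords_ne_zero hv, vortexMap_unordered hv⟩,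
      vortexMap_rotateVortices⟩,
    ⟨LinearEquiv.ofBijective _ (binaryFormSection_bijective k),
      fun w x hx => binaryFormSection_apply w hx⟩,
    fun A lam => ⟨fun p => finite_cohomology k _ p,
      fun q hq => equivariantEuler_eq_gaussBinom k _ hq,
      fun q => tendsto_gaussBinom_equivariantEuler k _ q, ?_, ?_, ?_⟩,
    fun A => ⟨fun q hq => ?_, fun q => ?_⟩, fun n => ?_⟩
  · rw [localAbelianHilbert_zero_genus, ← equivariantEuler_one_eq_choose]
    exact (continuous_equivariantEuler k _).continuousAt.tendsto.mono_left nhdsWithin_le_nhds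
  · rw [localAbelianHilbert_zero_genus, equivariantEuler_one_eq_choose]
  · rw [localAbelianHilbert_zero_genus]
    have h := (equivariantEuler_one k (lam * (A - k))).symm.trans
      (equivariantEuler_one_eq_choose k _)
    exact_mod_cast h
  · rw [equivariantEuler_eq_gaussBinom k _ hq, sub_add_cancel]
  · simpa only [sub_add_cancel] using tendsto_gaussBinom_equivariantEuler k (A - k) q
  · have h := tendsto_gaussBinom k (n - k) one_ne_zero
    rw [monomialCharacter_one] at h
    simpa only [sub_add_cancel] using h
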